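/- Let $X$ be a Banach space over $\mathbb T\in\{\mathbb R,\mathbb C\}$ and let $L(E)$ denote the bounded linear operators on a normed space $E$. For $S:[0,\infty)\to L(E)$ let $S'(0)$ be the linear operator $S'(0)x=\lim_{h\to 0+}h^{-1}(S(h)x-S(0)x)$ (norm limit), whose domain $D(S'(0))$ is the set of all $x\in E$ for which the limit exists. Let $\mathcal F_X$ be the set of all $F:[0,\infty)\to L(X)$ such that $F(0)=I$, $D(F'(0))$ is dense in $X$, and there are $M\ge 1$, $a\in\mathbb R$ with $\|F(s/n)^m\|\le M e^{asm/n}$ for all $m,n\in\mathbb N$, $n\geq 1$, and all $s\ge 0$. For $F\in\mathcal F_X$ let $F^*:[0,\infty)\to L(X^*)$, $F^*(s)=(F(s))^*$, so that $(F^*)'(0)$ is defined by norm limits in $X^*$. A $C_0$-semigroup is a strongly continuous map $T:[0,\infty)\to L(X)$ with $T(0)=I$, $T(l+m)=T(l)T(m)$ and $\|T(s)\|\le Me^{as}$ for some $M>1$, $a\in\mathbb R$; its generator is $T'(0)$, and one writes $T(s)=\exp(sT'(0))$. Theorem. Let $Z$ be a densely defined linear operator in $X$ with domain $D(Z)$ and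 let $t>0$. Then $Z$ is closable and its closure $\overline Z$ is the generator of a $C_0$-semigroup if and only if there exists $F\in\mathcal F_X$ such that: (i) $D(Z)\subseteq D(F'(0))$ and $F'(0)f=Zf$ for all $f\in D(Z)$; (ii) $D((F^*)'(0))$ is weak-$*$ dense in $X^*$; (iii) there is a linear subspace $A\subseteq D(Z)$, dense in $X$, such that for all $f\in A$ and $s\ge 0$ there is a sequence $(f_n)_{n\geq 1}$ in $D(Z)$ satisfying (a) $\lim_{n\to\infty}\|F(t/n)^{[ns]}f-f_n\|=0$, where $[ns]$ is the integer part of $ns$; (b) every subsequence of $(f_n)$ has a further subsequence converging weakly in $X$; (c) every subsequence of $(Zf_n)$ has a further subsequence converging weakly in $X$. Furthermore, whenever $F\in\mathcal F_X$ satisfies (i)–(iii), the $C_0$-semigroup generated by $\overline Z$ is unique and $\exp(s\overline Z)f=\lim_{n\to\infty}F(s/n)^nf$ in norm, for all $s>0$ and $f\in X$. -/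

import Mathlib

open Filter Topology NNReal

namespace ChernoffFormula

noncomputable section

variable {𝕜 E : Type*} [RCLike 𝕜] [NormedAddCommGroup E] [NormedSpace 𝕜 E]

/-- `y` is the norm limit of `h⁻¹ (S h x - S 0 x)` as `h → 0`, `h > 0`. -/
def HasStrongDerivAtZero (S : ℝ≥0 → E →L[𝕜] E) (x y : E) : Prop :=
  Tendsto (fun h : ℝ≥0 => (((h : ℝ) : 𝕜)⁻¹) • (S h x - S 0 x)) (𝓝[≠] 0) (𝓝 y)

theorem neBot_nhdsNE_zero : (𝓝[≠] (0 : ℝ≥0)).NeBot :=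
  (inferInstance : (𝓝[>] (0 : ℝ≥0)).NeBot).mono (nhdsWithin_mono _ fun _ hx => ne_of_gt hx)

theorem HasStrongDerivAtZero.unique {S : ℝ≥0 → E →L[𝕜] E} {x y z : E}
    (hy : HasStrongDerivAtZero S x y) (hz : HasStrongDerivAtZero S x z) : y = z :=
  haveI := neBot_nhdsNE_zero
  tendsto_nhds_unique hy hz

theorem HasStrongDerivAtZero.zero (S : ℝ≥0 → E →L[𝕜] E) : HasStrongDerivAtZero S 0 0 := by
  simp [HasStrongDerivAtZero]

theorem HasStrongDerivAtZero.add {S : ℝ≥0 → E →L[𝕜] E} {x x' y y' : E}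
    (h : HasStrongDerivAtZero S x y) (h' : HasStrongDerivAtZero S x' y') :
    HasStrongDerivAtZero S (x + x') (y + y') := by
  refine (Tendsto.add h h').congr fun s => ?_
  rw [← smul_add, map_add, map_add]
  congr 1
  abel

theorem HasStrongDerivAtZero.smul {S : ℝ≥0 → E →L[𝕜] E} {x y : E} (c : 𝕜)
    (h : HasStrongDerivAtZero S x y) : HasStrongDerivAtZero S (c • x) (c • y) := by
  refine (Tendsto.const_smul h c).congr fun s => ?_
  rw [map_smul, map_smul, ← smul_sub, smul_comm]

/-- The strong derivative `S'(0)` of `S : [0, ∞) → L(E)` at `0`, as a partially defined linear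
operator; its domain consists of all vectors at which the limit exists. -/
def strongDeriv (S : ℝ≥0 → E →L[𝕜] E) : E →ₗ.[𝕜] E where
  domain :=
    { carrier := {x | ∃ y, HasStrongDerivAtZero S x y}
      zero_mem' := ⟨0, HasStrongDerivAtZero.zero S⟩
      add_mem' := fun ⟨y, h⟩ ⟨y', h'⟩ => ⟨y + y', h.add h'⟩
      smul_mem' := fun c _ ⟨y, h⟩ => ⟨c • y, h.smul c⟩ }
  toFun :=
    { toFun := fun x => x.2.choose
      map_add' := fun x x' =>
        (x + x').2.choose_spec.unique (x.2.choose_spec.add x'.2.choose_spec)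
      map_smul' := fun c x => (c • x).2.choose_spec.unique (x.2.choose_spec.smul c) }

theorem mem_strongDeriv_domain {S : ℝ≥0 → E →L[𝕜] E} {x : E} :
    x ∈ (strongDeriv S).domain ↔ ∃ y, HasStrongDerivAtZero S x y := Iff.rfl

theorem strongDeriv_apply (S : ℝ≥0 → E →L[𝕜] E) (x : (strongDeriv S).domain) :
    HasStrongDerivAtZero S x (strongDeriv S x) := x.2.choose_spec

/-- The class `𝓕_E`: `F(0) = I`, the stability bound `‖F(s/n)^m‖ ≤ M exp(a m s / n)` holds for
some `M ≥ 1` and real `a`, and the domain of `F'(0)` is dense in `E`. -/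
def IsChernoffClass (F : ℝ≥0 → E →L[𝕜] E) : Prop :=
  F 0 = ContinuousLinearMap.id 𝕜 E ∧
  (∃ M a : ℝ, 1 ≤ M ∧ ∀ n m : ℕ, 0 < n → ∀ s : ℝ≥0,
    ‖F (s / n) ^ m‖ ≤ M * Real.exp (a * m / n * s)) ∧
  Dense ((strongDeriv F).domain : Set E)

/-- `C₀`-semigroups; continuity is with respect to the strong operator topology. -/
structure IsC0Semigroup (T : ℝ≥0 → E →L[𝕜] E) : Prop where
  map_zero : T 0 = ContinuousLinearMap.id 𝕜 E
  map_add : ∀ l m : ℝ≥0, T (l + m) = (T l).comp (T m)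
  continuous : ∀ x : E, Continuous fun s => T s x
  bound : ∃ M a : ℝ, 1 < M ∧ ∀ s : ℝ≥0, ‖T s‖ ≤ M * Real.exp (a * s)

/-- `A` is the generator of the `C₀`-semigroup `T`, i.e. `T s = exp (s A)`. -/
def IsGeneratorOf (A : E →ₗ.[𝕜] E) (T : ℝ≥0 → E →L[𝕜] E) : Prop :=
  IsC0Semigroup T ∧ strongDeriv T = A

/-- The function `F^*` with `F^*(s) = (F(s))^*` acting on the Banach space `E^*`. -/
def dualFun (F : ℝ≥0 → E →L[𝕜] E) : ℝ≥0 → StrongDual 𝕜 E →L[𝕜] StrongDual 𝕜 E :=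
  fun s => ContinuousLinearMap.precomp 𝕜 (F s)

/-- A set of continuous functionals is dense in `E^*` for the weak-* topology. -/
def WeakStarDense (D : Set (StrongDual 𝕜 E)) : Prop :=
  Dense (StrongDual.toWeakDual '' D : Set (WeakDual 𝕜 E))

variable (𝕜) in
/-- Every subsequence of `u` has a weakly convergent subsequence (with limit in `E`). -/
def WeaklySeqRelCompact (u : ℕ → E) : Prop :=
  ∀ p : ℕ → ℕ, StrictMono p → ∃ q : ℕ → ℕ, StrictMono q ∧ ∃ x : E,
    Tendsto (fun k => toWeakSpace 𝕜 E (u (p (q k)))) atTop (𝓝 (toWeakSpace 𝕜 E x))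

/-- Conditions (i), (ii), (iii) relating the operator `Z`, the function `F` and the number `t`. -/
structure ChernoffConditions (t : ℝ≥0) (Z : E →ₗ.[𝕜] E) (F : ℝ≥0 → E →L[𝕜] E) : Prop where
  extends_op : Z ≤ strongDeriv F
  dual_dense : WeakStarDense ((strongDeriv (dualFun F)).domain : Set (StrongDual 𝕜 E))
  approx : ∃ A : Submodule 𝕜 E, A ≤ Z.domain ∧ Dense (A : Set E) ∧
    ∀ f ∈ A, ∀ s : ℝ≥0, ∃ u : ℕ → Z.domain,
      Tendsto (fun n : ℕ => ‖(F (t / n) ^ ⌊n * s⌋₊) f - (u n : E)‖) atTop (𝓝 0) ∧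
      WeaklySeqRelCompact 𝕜 (fun n => (u n : E)) ∧
      WeaklySeqRelCompact 𝕜 (fun n => Z (u n))

end

end ChernoffFormula

namespace ChernoffFormula

section StrongLimits

variable {𝕜 X ι : Type*} [RCLike 𝕜] [NormedAddCommGroup X] [NormedSpace 𝕜 X]

theorem norm_apply_le_of_le {T : X →L[𝕜] X} {C : ℝ} (hT : ‖T‖ ≤ C) (x : X) :
    ‖T x‖ ≤ C * ‖x‖ :=
  T.le_of_opNorm_le hT x

/-- If equibounded operators converge strongly on a dense set, they converge strongly. -/
theorem tendsto_apply_of_dense {l : Filter ι} {T : ι → X →L[𝕜] X} {S : X →L[𝕜] X} {C : ℝ}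
    (hC : ∀ᶠ i in l, ‖T i‖ ≤ C) {D : Set X} (hD : Dense D)
    (h : ∀ x ∈ D, Tendsto (fun i => T i x) l (𝓝 (S x))) (x : X) :
    Tendsto (fun i => T i x) l (𝓝 (S x)) := by
  rw [Metric.tendsto_nhds]
  intro ε hε
  set K := |C| + ‖S‖ + 1 with hK
  have hKpos : 0 < K := by positivity
  obtain ⟨y, hy, hxy⟩ := Metric.dense_iff.1 hD x (ε / (2 * K)) (by positivity)
  rw [Metric.mem_ball, dist_comm, dist_eq_norm] at hy
  filter_upwards [hC, Metric.tendsto_nhds.1 (h y hxy) (ε / 2) (by positivity)] with i hi hi'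
  rw [dist_eq_norm] at hi' ⊢
  have e : T i x - S x = T i (x - y) - S (x - y) + (T i y - S y) := by
    simp only [map_sub]; abel
  have h1 : ‖T i (x - y)‖ ≤ |C| * ‖x - y‖ :=
    norm_apply_le_of_le (hi.trans (le_abs_self C)) _
  have h2 : ‖S (x - y)‖ ≤ ‖S‖ * ‖x - y‖ := S.le_opNorm _
  have h3 : (|C| + ‖S‖) * ‖x - y‖ ≤ K * ‖x - y‖ :=
    mul_le_mul_of_nonneg_right (by rw [hK]; linarith) (norm_nonneg _)
  have h4 : K * ‖x - y‖ < ε / 2 := by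
    calc K * ‖x - y‖ < K * (ε / (2 * K)) := mul_lt_mul_of_pos_left hy hKpos
      _ = ε / 2 := by field_simp
  rw [e]
  calc _ ≤ ‖T i (x - y)‖ + ‖S (x - y)‖ + ‖T i y - S y‖ :=
        (norm_add_le _ _).trans (add_le_add_left (norm_sub_le _ _) _)
    _ < ε := by linarith

/-- Strong limits of equibounded operators exist if they exist on a dense set. -/
theorem exists_strong_limit [CompleteSpace X] {l : Filter ι} [l.NeBot] {T : ι → X →L[𝕜] X} {C : ℝ}
    (hC : ∀ᶠ i in l, ‖T i‖ ≤ C) {D : Set X} (hD : Dense D)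
    (h : ∀ x ∈ D, Cauchy (map (fun i => T i x) l)) :
    ∃ S : X →L[𝕜] X, ‖S‖ ≤ C ∧ ∀ x, Tendsto (fun i => T i x) l (𝓝 (S x)) := by
  have key : ∀ x, ∃ y, Tendsto (fun i => T i x) l (𝓝 y) := by
    intro x
    apply cauchy_map_iff_exists_tendsto.1
    rw [Metric.cauchy_iff]
    refine ⟨inferInstance, fun ε hε => ?_⟩
    set K := |C| + 1 with hK
    have hKpos : 0 < K := by positivity
    obtain ⟨y, hy, hxy⟩ := Metric.dense_iff.1 hD x (ε / (3 * K)) (by positivity)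
    rw [Metric.mem_ball, dist_comm, dist_eq_norm] at hy
    obtain ⟨t, ht, ht'⟩ := (Metric.cauchy_iff.1 (h y hxy)).2 (ε / 3) (by positivity)
    refine ⟨(fun i => T i x) '' ({i | T i y ∈ t} ∩ {i | ‖T i‖ ≤ C}),
      image_mem_map (inter_mem ht hC), ?_⟩
    rintro _ ⟨i, ⟨hi, hiC⟩, rfl⟩ _ ⟨j, ⟨hj, hjC⟩, rfl⟩
    have hij := ht' _ hi _ hj
    rw [dist_eq_norm] at hij ⊢
    have e : T i x - T j x = T i (x - y) - T j (x - y) + (T i y - T j y) := by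
      simp only [map_sub]; abel
    have hb : ∀ k, ‖T k‖ ≤ C → ‖T k (x - y)‖ < ε / 3 := fun k hk => by
      calc ‖T k (x - y)‖ ≤ K * ‖x - y‖ :=
            norm_apply_le_of_le (hk.trans ((le_abs_self C).trans (by rw [hK]; linarith))) _
        _ < K * (ε / (3 * K)) := mul_lt_mul_of_pos_left hy hKpos
        _ = ε / 3 := by field_simp
    rw [e]
    calc _ ≤ ‖T i (x - y)‖ + ‖T j (x - y)‖ + ‖T i y - T j y‖ :=
          (norm_add_le _ _).trans (add_le_add_left (norm_sub_le _ _) _)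
      _ < ε := by linarith [hb i hiC, hb j hjC]
  choose S hS using key
  obtain ⟨i₀, hi₀⟩ := hC.exists
  have hC0 : 0 ≤ C := (norm_nonneg _).trans hi₀
  let L : X →ₗ[𝕜] X :=
    { toFun := S
      map_add' := fun x y => tendsto_nhds_unique (hS (x + y))
        (((hS x).add (hS y)).congr fun i => (map_add _ _ _).symm)
      map_smul' := fun c x => tendsto_nhds_unique (hS (c • x))
        (((hS x).const_smul c).congr fun i => (map_smul _ _ _).symm) }
  have hL : ∀ x, ‖L x‖ ≤ C * ‖x‖ := fun x =>
    le_of_tendsto (hS x).norm (hC.mono fun i hi => norm_apply_le_of_le hi x)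
  exact ⟨L.mkContinuous C hL, L.mkContinuous_norm_le hC0 hL, hS⟩

/-- Strong convergence of equibounded operators is uniform on compact sets. -/
theorem eventually_forall_norm_sub_lt_of_isCompact {l : Filter ι} {T : ι → X →L[𝕜] X}
    {S : X →L[𝕜] X} {C : ℝ} (hC : ∀ᶠ i in l, ‖T i‖ ≤ C)
    (h : ∀ x, Tendsto (fun i => T i x) l (𝓝 (S x))) {K : Set X} (hK : IsCompact K)
    {ε : ℝ} (hε : 0 < ε) : ∀ᶠ i in l, ∀ x ∈ K, ‖T i x - S x‖ < ε := by
  set L := |C| + ‖S‖ + 1 with hL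
  have hLpos : 0 < L := by positivity
  obtain ⟨t, ht, hKt⟩ := Metric.totallyBounded_iff.1 hK.totallyBounded (ε / (2 * L)) (by positivity)
  have h1 : ∀ᶠ i in l, ∀ y ∈ t, ‖T i y - S y‖ < ε / 2 := by
    rw [eventually_all_finite ht]
    intro y _
    simpa [dist_eq_norm] using Metric.tendsto_nhds.1 (h y) (ε / 2) (by positivity)
  filter_upwards [hC, h1] with i hi hi' x hx
  obtain ⟨y, hy, hxy⟩ := Set.mem_iUnion₂.1 (hKt hx)
  rw [Metric.mem_ball, dist_eq_norm] at hxy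
  have e : T i x - S x = T i (x - y) - S (x - y) + (T i y - S y) := by
    simp only [map_sub]; abel
  have h2 : ‖T i (x - y)‖ ≤ |C| * ‖x - y‖ :=
    norm_apply_le_of_le (hi.trans (le_abs_self C)) _
  have h3 : ‖S (x - y)‖ ≤ ‖S‖ * ‖x - y‖ := S.le_opNorm _
  have h4 : (|C| + ‖S‖) * ‖x - y‖ ≤ L * ‖x - y‖ :=
    mul_le_mul_of_nonneg_right (by rw [hL]; linarith) (norm_nonneg _)
  have h5 : L * ‖x - y‖ < ε / 2 := by
    calc L * ‖x - y‖ < L * (ε / (2 * L)) := mul_lt_mul_of_pos_left hxy hLpos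
      _ = ε / 2 := by field_simp
  rw [e]
  calc _ ≤ ‖T i (x - y)‖ + ‖S (x - y)‖ + ‖T i y - S y‖ :=
        (norm_add_le _ _).trans (add_le_add_left (norm_sub_le _ _) _)
    _ < ε := by linarith [hi' y hy]

/-- Applying equibounded strongly convergent operators to a convergent family of vectors. -/
theorem tendsto_apply_apply {l : Filter ι} {T : ι → X →L[𝕜] X} {C : ℝ}
    (hC : ∀ᶠ i in l, ‖T i‖ ≤ C) {u : ι → X} {x y : X} (hu : Tendsto u l (𝓝 x))
    (h : Tendsto (fun i => T i x) l (𝓝 y)) : Tendsto (fun i => T i (u i)) l (𝓝 y) := by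
  have h0 : Tendsto (fun i => T i (u i - x)) l (𝓝 0) := by
    refine squeeze_zero_norm' (a := fun i => C * ‖u i - x‖)
      (hC.mono fun i hi => norm_apply_le_of_le hi _) ?_
    have := (tendsto_iff_norm_sub_tendsto_zero.1 hu).const_mul C
    simpa using this
  refine (by simpa using h0.add h : Tendsto _ l (𝓝 y)).congr fun i => ?_
  simp

end StrongLimits

section Neumann

variable {𝕜 X : Type*} [RCLike 𝕜] [NormedAddCommGroup X] [NormedSpace 𝕜 X] [CompleteSpace X]

theorem hasSum_sub_succ {A : Type*} [NormedAddCommGroup A] {g : ℕ → A} (hg : Summable g) :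
    HasSum (fun i => g i - g (i + 1)) (g 0) := by
  simpa using hg.hasSum.sub ((hasSum_nat_add_iff' 1).2 hg.hasSum)

/-- Neumann series: if `‖B ^ k‖ ≤ M b ^ k` and `b < c`, then `c - B` is invertible and the powers
of its inverse satisfy the Hille–Yosida type bound. -/
theorem exists_inverse_of_pow_bound (B : X →L[𝕜] X) {M b c : ℝ} (hb : 0 ≤ b)
    (hbc : b < c) (hB : ∀ k, ‖B ^ k‖ ≤ M * b ^ k) :
    ∃ R : X →L[𝕜] X, ((c : 𝕜) • (1 : X →L[𝕜] X) - B) * R = 1 ∧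
      R * ((c : 𝕜) • (1 : X →L[𝕜] X) - B) = 1 ∧ ∀ j, ‖R ^ j‖ ≤ M * ((c - b)⁻¹) ^ j := by
  have hc : 0 < c := hb.trans_lt hbc
  have hc' : (c : 𝕜) ≠ 0 := by exact_mod_cast hc.ne'
  have hcb : 0 < c - b := sub_pos.2 hbc
  set f : ℕ → X →L[𝕜] X := fun i => ((c : 𝕜)⁻¹) ^ (i + 1) • B ^ i with hf
  have hgeo : HasSum (fun i : ℕ => c⁻¹ ^ (i + 1) * b ^ i) (c - b)⁻¹ := by
    have h1 := (hasSum_geometric_of_lt_one (r := b / c) (by positivity)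
      ((div_lt_one hc).2 hbc)).mul_left c⁻¹
    have e : c⁻¹ * (1 - b / c)⁻¹ = (c - b)⁻¹ := by
      rw [← mul_inv]; congr 1; field_simp
    rw [e] at h1
    refine h1.congr_fun fun i => ?_
    rw [pow_succ', div_pow, inv_pow]; ring
  have hnc : ‖(c : 𝕜)⁻¹‖ = c⁻¹ := by
    rw [norm_inv, RCLike.norm_ofReal, abs_of_pos hc]
  have hfn : ∀ i, ‖f i‖ ≤ M * (c⁻¹ ^ (i + 1) * b ^ i) := by
    intro i
    rw [hf]
    simp only [norm_smul, norm_pow, hnc]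
    calc _ ≤ c⁻¹ ^ (i + 1) * (M * b ^ i) := by gcongr; exact hB i
      _ = _ := by ring
  have hs : Summable f := Summable.of_norm_bounded (hgeo.mul_left M).summable hfn
  obtain ⟨R, hR⟩ := hs
  have hg : Summable fun i => ((c : 𝕜)⁻¹) ^ i • B ^ i := by
    refine (hR.summable.const_smul (c : 𝕜)).congr fun i => ?_
    rw [hf, smul_smul, pow_succ', mul_inv_cancel_left₀ hc']
  have htel : HasSum (fun i => ((c : 𝕜)⁻¹) ^ i • B ^ i - ((c : 𝕜)⁻¹) ^ (i + 1) • B ^ (i + 1))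
      (1 : X →L[𝕜] X) := by
    have := hasSum_sub_succ hg
    rwa [pow_zero, one_smul, pow_zero] at this
  have e1 : ((c : 𝕜) • (1 : X →L[𝕜] X) - B) * R = 1 := by
    refine (hR.mul_left _).unique ?_
    refine htel.congr_fun fun i => ?_
    rw [hf, sub_mul, smul_mul_assoc, one_mul, mul_smul_comm, smul_smul, ← pow_succ' B i,
      pow_succ' ((c : 𝕜)⁻¹) i, mul_inv_cancel_left₀ hc']
  have e2 : R * ((c : 𝕜) • (1 : X →L[𝕜] X) - B) = 1 := by
    refine (hR.mul_right _).unique ?_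
    refine htel.congr_fun fun i => ?_
    rw [hf, mul_sub, mul_smul_comm, mul_one, smul_mul_assoc, smul_smul, ← pow_succ B i,
      pow_succ' ((c : 𝕜)⁻¹) i, mul_inv_cancel_left₀ hc']
  refine ⟨R, e1, e2, fun j => ?_⟩
  have key : ∀ j k, ‖R ^ j * B ^ k‖ ≤ M * ((c - b)⁻¹) ^ j * b ^ k := by
    intro j
    induction j with
    | zero => intro k; simpa using hB k
    | succ j ih =>
      intro k
      have hsum := (hR.mul_right (B ^ k)).mul_left (R ^ j)
      rw [← mul_assoc, ← pow_succ] at hsum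
      rw [← hsum.tsum_eq]
      have hg := hgeo.mul_left (M * ((c - b)⁻¹) ^ j * b ^ k)
      have e : M * ((c - b)⁻¹) ^ j * b ^ k * (c - b)⁻¹ = M * ((c - b)⁻¹) ^ (j + 1) * b ^ k := by
        ring
      rw [e] at hg
      refine tsum_of_norm_bounded hg fun i => ?_
      rw [hf]
      simp only [smul_mul_assoc, mul_smul_comm, norm_smul, norm_pow, hnc, ← pow_add]
      calc _ ≤ c⁻¹ ^ (i + 1) * (M * ((c - b)⁻¹) ^ j * b ^ (i + k)) := by gcongr; exact ih _
        _ = _ := by ring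
  simpa using key j 0

end Neumann

section Exponential

variable {𝕜 X : Type*} [RCLike 𝕜] [NormedAddCommGroup X] [NormedSpace 𝕜 X]

theorem tendsto_ofReal_nhdsNE_zero :
    Tendsto (fun h : ℝ≥0 => ((h : ℝ) : 𝕜)) (𝓝[≠] 0) (𝓝[≠] 0) := by
  refine tendsto_nhdsWithin_iff.2 ⟨?_, ?_⟩
  · have : Continuous fun h : ℝ≥0 => ((h : ℝ) : 𝕜) :=
      RCLike.continuous_ofReal.comp NNReal.continuous_coe
    simpa using (this.tendsto 0).mono_left nhdsWithin_le_nhds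
  · filter_upwards [self_mem_nhdsWithin] with h hh
    simpa using hh

theorem exp_ofReal_smul_one (r : ℝ) :
    NormedSpace.exp ((r : 𝕜) • (1 : X →L[𝕜] X)) = (Real.exp r : 𝕜) • (1 : X →L[𝕜] X) := by
  have h1 := NormedSpace.algebraMap_exp_comm (𝕂 := 𝕜) (𝔸 := X →L[𝕜] X) (r : 𝕜)
  have h2 := NormedSpace.algebraMap_exp_comm (𝕂 := ℝ) (𝔸 := 𝕜) r
  rw [Algebra.algebraMap_eq_smul_one, Algebra.algebraMap_eq_smul_one] at h1
  rw [← h1, Real.exp_eq_exp_ℝ]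
  congr 1
  exact h2.symm

/-- A power bound `‖R ^ k‖ ≤ M r ^ k` yields `‖exp (v R)‖ ≤ M exp (v r)`. -/
theorem norm_exp_smul_le {R : X →L[𝕜] X} {M r : ℝ} (hR : ∀ k, ‖R ^ k‖ ≤ M * r ^ k) {v : ℝ}
    (hv : 0 ≤ v) : ‖NormedSpace.exp ((v : 𝕜) • R)‖ ≤ M * Real.exp (v * r) := by
  rw [NormedSpace.exp_eq_tsum 𝕜]
  have hs : HasSum (fun k : ℕ => M * ((v * r) ^ k / k.factorial)) (M * Real.exp (v * r)) := by
    have := NormedSpace.expSeries_div_hasSum_exp (v * r)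
    rw [← Real.exp_eq_exp_ℝ] at this
    exact this.mul_left M
  refine tsum_of_norm_bounded hs fun k => ?_
  rw [smul_pow, norm_smul, norm_smul, norm_inv, norm_pow, RCLike.norm_ofReal, abs_of_nonneg hv,
    RCLike.norm_natCast]
  calc _ ≤ ((k.factorial : ℝ)⁻¹) * (v ^ k * (M * r ^ k)) := by gcongr; exact hR k
    _ = _ := by rw [mul_pow]; field_simp

variable [CompleteSpace X]

theorem exp_add_of_commute_clm {A B : X →L[𝕜] X} (h : Commute A B) :
    NormedSpace.exp (A + B) = NormedSpace.exp A * NormedSpace.exp B := by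
  let : NormedAlgebra ℚ (X →L[𝕜] X) := NormedAlgebra.restrictScalars ℚ 𝕜 _
  exact NormedSpace.exp_add_of_commute h

theorem exp_pow_clm (A : X →L[𝕜] X) (n : ℕ) :
    NormedSpace.exp A ^ n = NormedSpace.exp ((n : 𝕜) • A) := by
  let : NormedAlgebra ℚ (X →L[𝕜] X) := NormedAlgebra.restrictScalars ℚ 𝕜 _
  rw [← NormedSpace.exp_nsmul, Nat.cast_smul_eq_nsmul]

theorem tendsto_exp_slope_zero (A : X →L[𝕜] X) :
    Tendsto (fun h : ℝ≥0 => (((h : ℝ) : 𝕜)⁻¹) •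
      (NormedSpace.exp (((h : ℝ) : 𝕜) • A) - 1)) (𝓝[≠] 0) (𝓝 A) := by
  have h1 := hasDerivAt_exp_smul_const A (0 : 𝕜)
  rw [hasDerivAt_iff_tendsto_slope_zero] at h1
  simp only [zero_smul, NormedSpace.exp_zero, one_mul, zero_add] at h1
  exact h1.comp tendsto_ofReal_nhdsNE_zero

/-- `s / n → 0` within the punctured neighbourhood. -/
theorem tendsto_div_nat_nhdsNE {s : ℝ≥0} (hs : 0 < s) :
    Tendsto (fun n : ℕ => s / (n : ℝ≥0)) atTop (𝓝[≠] 0) := by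
  refine tendsto_nhdsWithin_iff.2 ⟨?_, ?_⟩
  · exact (tendsto_const_div_atTop_nhds_zero_nat (s : ℝ≥0))
  · filter_upwards [eventually_gt_atTop 0] with n hn
    exact (div_pos hs (by exact_mod_cast hn)).ne'

/-- Two commuting uniformly continuous semigroups are compared through their generators. -/
theorem norm_exp_sub_exp_le {A B : X →L[𝕜] X} (hAB : Commute A B) {K w : ℝ} (hw : 0 ≤ w)
    (hA : ∀ s : ℝ≥0, ‖NormedSpace.exp (((s : ℝ) : 𝕜) • A)‖ ≤ K * Real.exp (w * s))
    (hB : ∀ s : ℝ≥0, ‖NormedSpace.exp (((s : ℝ) : 𝕜) • B)‖ ≤ K * Real.exp (w * s))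
    (s : ℝ≥0) (x : X) :
    ‖NormedSpace.exp (((s : ℝ) : 𝕜) • A) x - NormedSpace.exp (((s : ℝ) : 𝕜) • B) x‖ ≤
      K ^ 2 * Real.exp (w * s) * s * ‖A x - B x‖ := by
  rcases eq_or_ne s 0 with rfl | hs
  · simp
  have hs0 : 0 < s := pos_iff_ne_zero.2 hs
  have hK : 0 ≤ K := by
    have := (norm_nonneg _).trans (hA 0)
    simpa using this
  have hstep : ∀ n : ℕ, 0 < n →
      ‖NormedSpace.exp (((s : ℝ) : 𝕜) • A) x - NormedSpace.exp (((s : ℝ) : 𝕜) • B) x‖ ≤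
      K ^ 2 * Real.exp (w * s) * (n * ‖(NormedSpace.exp ((((s / n : ℝ≥0) : ℝ) : 𝕜) • A)) x
        - (NormedSpace.exp ((((s / n : ℝ≥0) : ℝ) : 𝕜) • B)) x‖) := by
    intro n hn
    have hn' : (n : ℝ) ≠ 0 := by positivity
    set h : ℝ≥0 := s / n with hh
    set U := NormedSpace.exp (((h : ℝ) : 𝕜) • A) with hU
    set V := NormedSpace.exp (((h : ℝ) : 𝕜) • B) with hV
    have hpow : ∀ (C : X →L[𝕜] X) (k : ℕ), NormedSpace.exp (((h : ℝ) : 𝕜) • C) ^ k =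
        NormedSpace.exp ((((k * h : ℝ≥0) : ℝ) : 𝕜) • C) := by
      intro C k
      rw [exp_pow_clm, smul_smul]
      push_cast
      rfl
    have hnh : (n : ℝ≥0) * h = s := by
      rw [hh]; field_simp
    have hUV : Commute U V := by
      have : Commute (((h : ℝ) : 𝕜) • A) (((h : ℝ) : 𝕜) • B) := (hAB.smul_left _).smul_right _
      exact this.exp
    have e := hUV.geom_sum₂_mul n
    rw [hpow A n, hpow B n, hnh] at e
    rw [← _root_.sub_apply, ← e]
    change ‖(∑ i ∈ Finset.range n, U ^ i * V ^ (n - 1 - i)) ((U - V) x)‖ ≤ _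
    have hsum : ‖∑ i ∈ Finset.range n, U ^ i * V ^ (n - 1 - i)‖ ≤
        ∑ i ∈ Finset.range n, K ^ 2 * Real.exp (w * s) := by
      refine norm_sum_le_of_le _ fun i hi => ?_
      have hi' : i + (n - 1 - i) ≤ n := by have := Finset.mem_range.1 hi; omega
      have hi'' : (i : ℝ) + ((n - 1 - i : ℕ) : ℝ) ≤ n := by exact_mod_cast hi'
      generalize n - 1 - i = m at hi' hi''
      rw [hU, hV, hpow A i, hpow B]
      calc _ ≤ _ := norm_mul_le _ _
        _ ≤ (K * Real.exp (w * ((i * h : ℝ≥0) : ℝ))) *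
            (K * Real.exp (w * ((m * h : ℝ≥0) : ℝ))) := by
          gcongr
          · exact hA _
          · exact hB _
        _ = K ^ 2 * Real.exp (w * ((i + m) * h)) := by
          push_cast
          rw [show w * (((i : ℝ) + m) * (h : ℝ)) = w * (i * h) + w * ((m : ℝ) * h) by ring,
            Real.exp_add]
          ring
        _ ≤ K ^ 2 * Real.exp (w * s) := by
          gcongr
          calc _ ≤ (n : ℝ) * h := by gcongr
            _ = s := by exact_mod_cast hnh
    rw [Finset.sum_const, Finset.card_range, nsmul_eq_mul] at hsum
    calc _ ≤ (n * (K ^ 2 * Real.exp (w * s))) * ‖(U - V) x‖ := norm_apply_le_of_le hsum _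
      _ = _ := by simp only [_root_.sub_apply]; ring
  have hlim : Tendsto (fun n : ℕ => (n * ‖(NormedSpace.exp ((((s / n : ℝ≥0) : ℝ) : 𝕜) • A)) x
        - (NormedSpace.exp ((((s / n : ℝ≥0) : ℝ) : 𝕜) • B)) x‖)) atTop (𝓝 (s * ‖A x - B x‖)) := by
    have h1 := ((tendsto_exp_slope_zero A).sub (tendsto_exp_slope_zero B)).comp
      (tendsto_div_nat_nhdsNE hs0)
    have h2 : Tendsto (fun T : X →L[𝕜] X => (s : ℝ) * ‖T x‖) (𝓝 (A - B)) (𝓝 (s * ‖(A - B) x‖)) :=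
      Continuous.tendsto (by fun_prop) _
    refine (h2.comp h1).congr' ?_
    filter_upwards [eventually_gt_atTop 0] with n hn
    have hn' : (n : ℝ) ≠ 0 := by positivity
    have hs' : (s : ℝ) ≠ 0 := by exact_mod_cast hs
    simp only [Function.comp_apply, ← smul_sub, sub_sub_sub_cancel_right,
      _root_.smul_apply, norm_smul, norm_inv, RCLike.norm_ofReal,
      _root_.sub_apply, NNReal.abs_eq, ← mul_assoc]
    congr 1
    push_cast
    field_simp
  have := ge_of_tendsto (hlim.const_mul (K ^ 2 * Real.exp (w * s)))
    ((eventually_gt_atTop 0).mono hstep)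
  calc _ ≤ _ := this
    _ = _ := by ring

end Exponential

section HilleYosida

variable {𝕜 X : Type*} [RCLike 𝕜] [NormedAddCommGroup X] [NormedSpace 𝕜 X]

/-- `G` is the graph of a densely defined operator whose resolvent at each real `c > w` is `R c`,
with the Hille–Yosida bounds on the powers of the resolvents. -/
structure IsResolventOf (R : ℝ → X →L[𝕜] X) (G : Submodule 𝕜 (X × X)) (M w : ℝ) : Prop where
  one_le : 1 ≤ M
  pos : 0 < w
  mem_iff : ∀ c, w < c → ∀ x z, (x, z) ∈ G ↔ R c ((c : 𝕜) • x - z) = x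
  pow_bound : ∀ c, w < c → ∀ j, ‖R c ^ j‖ ≤ M * ((c - w)⁻¹) ^ j
  dense : Dense {x : X | ∃ z, (x, z) ∈ G}

variable {R : ℝ → X →L[𝕜] X} {G : Submodule 𝕜 (X × X)} {M w : ℝ}

namespace IsResolventOf

theorem apply_mem (hR : IsResolventOf R G M w) {c : ℝ} (hc : w < c) (y : X) :
    (R c y, (c : 𝕜) • R c y - y) ∈ G := by
  rw [hR.mem_iff c hc, sub_sub_cancel]

theorem apply_of_mem (hR : IsResolventOf R G M w) {c : ℝ} (hc : w < c) {x z : X}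
    (h : (x, z) ∈ G) : R c z = (c : 𝕜) • R c x - x := by
  have := (hR.mem_iff c hc x z).1 h
  rw [map_sub, map_smul] at this
  exact eq_sub_iff_add_eq.2 (by rw [add_comm]; exact (sub_eq_iff_eq_add.1 this).symm)

theorem norm_le (hR : IsResolventOf R G M w) {c : ℝ} (hc : w < c) : ‖R c‖ ≤ M * (c - w)⁻¹ := by
  simpa using hR.pow_bound c hc 1

theorem commute (hR : IsResolventOf R G M w) {c d : ℝ} (hc : w < c) (hd : w < d) :
    Commute (R c) (R d) := by
  rcases eq_or_ne c d with rfl | hcd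
  · exact Commute.refl _
  ext y
  change R c (R d y) = R d (R c y)
  have h1 := hR.apply_of_mem hd (hR.apply_mem hc y)
  have h2 := hR.apply_of_mem hc (hR.apply_mem hd y)
  rw [map_sub, map_smul] at h1 h2
  have h3 : ((c : 𝕜) - d) • (R c (R d y) - R d (R c y)) = 0 := by
    have e1 := sub_eq_zero.2 h1
    have e2 := sub_eq_zero.2 h2
    rw [← sub_zero (0 : X)]
    nth_rw 1 [← neg_zero, ← e2, ← e1]
    module
  have h5 : ((c : 𝕜) - d) ≠ 0 := by
    rw [sub_ne_zero]; exact_mod_cast hcd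
  exact sub_eq_zero.1 ((smul_eq_zero.1 h3).resolve_left h5)

theorem tendsto_smul_apply (hR : IsResolventOf R G M w) (x : X) :
    Tendsto (fun c : ℝ => (c : 𝕜) • R c x) atTop (𝓝 x) := by
  have hb : ∀ᶠ c : ℝ in atTop, ‖(c : 𝕜) • R c‖ ≤ 2 * M := by
    filter_upwards [eventually_ge_atTop (2 * w)] with c hc
    have hw := hR.pos
    have hM := hR.one_le
    have hcw : 0 < c - w := by linarith
    rw [norm_smul, RCLike.norm_ofReal, abs_of_pos (by linarith)]
    calc c * ‖R c‖ ≤ c * (M * (c - w)⁻¹) := by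
          gcongr
          · linarith
          · exact hR.norm_le (by linarith)
      _ = M * (c * (c - w)⁻¹) := by ring
      _ ≤ M * 2 := by
          gcongr
          rw [← div_eq_mul_inv, div_le_iff₀ hcw]; linarith
      _ = 2 * M := mul_comm _ _
  refine tendsto_apply_of_dense (T := fun c : ℝ => (c : 𝕜) • R c)
    (S := ContinuousLinearMap.id 𝕜 X) hb hR.dense ?_ x
  rintro x ⟨z, hxz⟩
  have h0 : Tendsto (fun c : ℝ => R c z) atTop (𝓝 0) := by
    refine squeeze_zero_norm' (a := fun c => M * (c - w)⁻¹ * ‖z‖) ?_ ?_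
    · filter_upwards [eventually_gt_atTop w] with c hc
      exact norm_apply_le_of_le (hR.norm_le hc) z
    · have : Tendsto (fun c : ℝ => (c - w)⁻¹) atTop (𝓝 0) :=
        tendsto_inv_atTop_zero.comp (tendsto_atTop_add_const_right _ (-w) tendsto_id)
      simpa using (this.const_mul M).mul_const ‖z‖
  have h1 := h0.add_const x
  rw [zero_add] at h1
  refine h1.congr' ?_
  filter_upwards [eventually_gt_atTop w] with c hc
  rw [hR.apply_of_mem hc hxz]
  simp

/-- The graph determines its operator uniquely. -/
theorem eq_zero_of_mem (hR : IsResolventOf R G M w) {z : X} (h : ((0 : X), z) ∈ G) : z = 0 := by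
  refine tendsto_nhds_unique (hR.tendsto_smul_apply z) ?_
  refine tendsto_const_nhds.congr' ?_
  filter_upwards [eventually_gt_atTop w] with c hc
  rw [hR.apply_of_mem hc h]
  simp

end IsResolventOf

/-- The Yosida approximation `c ^ 2 R c - c`. -/
noncomputable def yosida (R : ℝ → X →L[𝕜] X) (c : ℝ) : X →L[𝕜] X :=
  ((c ^ 2 : ℝ) : 𝕜) • R c - (c : 𝕜) • 1

namespace IsResolventOf

theorem yosida_apply (hR : IsResolventOf R G M w) {c : ℝ} (hc : w < c) {x z : X}
    (h : (x, z) ∈ G) : yosida R c x = (c : 𝕜) • R c z := by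
  rw [hR.apply_of_mem hc h, smul_sub, smul_smul]
  simp [yosida, pow_two]

theorem tendsto_yosida (hR : IsResolventOf R G M w) {x z : X} (h : (x, z) ∈ G) :
    Tendsto (fun c => yosida R c x) atTop (𝓝 z) := by
  refine (hR.tendsto_smul_apply z).congr' ?_
  filter_upwards [eventually_gt_atTop w] with c hc
  rw [hR.yosida_apply hc h]

theorem commute_yosida_right (hR : IsResolventOf R G M w) {c d : ℝ} (hc : w < c) (hd : w < d) :
    Commute (R c) (yosida R d) :=
  ((hR.commute hc hd).smul_right _).sub_right ((Commute.one_right _).smul_right _)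

theorem commute_yosida (hR : IsResolventOf R G M w) {c d : ℝ} (hc : w < c) (hd : w < d) :
    Commute (yosida R c) (yosida R d) :=
  ((hR.commute_yosida_right hc hd).smul_left _).sub_left ((Commute.one_left _).smul_left _)

variable [CompleteSpace X]

theorem norm_exp_yosida_le (hR : IsResolventOf R G M w) {c : ℝ} (hc : 2 * w ≤ c) (s : ℝ≥0) :
    ‖NormedSpace.exp (((s : ℝ) : 𝕜) • yosida R c)‖ ≤ M * Real.exp (2 * w * s) := by
  have hw := hR.pos
  have hM := hR.one_le
  have hcw : 0 < c - w := by linarith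
  have e : ((s : ℝ) : 𝕜) • yosida R c =
      ((s * c ^ 2 : ℝ) : 𝕜) • R c + ((-(s * c) : ℝ) : 𝕜) • 1 := by
    rw [yosida]; push_cast; module
  rw [e, exp_add_of_commute_clm ((Commute.one_right _).smul_right _), exp_ofReal_smul_one,
    mul_smul_comm, mul_one, norm_smul, RCLike.norm_ofReal, abs_of_pos (Real.exp_pos _)]
  calc _ ≤ Real.exp (-(s * c)) * (M * Real.exp (s * c ^ 2 * (c - w)⁻¹)) := by
        gcongr
        exact norm_exp_smul_le (hR.pow_bound c (by linarith)) (by positivity)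
    _ = M * Real.exp (-(s * c) + s * c ^ 2 * (c - w)⁻¹) := by rw [Real.exp_add]; ring
    _ ≤ M * Real.exp (2 * w * s) := by
        gcongr
        have h1 : c ^ 2 * (c - w)⁻¹ ≤ c + 2 * w := by
          rw [← div_eq_mul_inv, div_le_iff₀ hcw]; nlinarith
        nlinarith [mul_le_mul_of_nonneg_left h1 s.coe_nonneg]

theorem norm_exp_yosida_sub_le (hR : IsResolventOf R G M w) {c d : ℝ} (hc : 2 * w ≤ c)
    (hd : 2 * w ≤ d) (s : ℝ≥0) (x : X) :
    ‖NormedSpace.exp (((s : ℝ) : 𝕜) • yosida R c) x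
      - NormedSpace.exp (((s : ℝ) : 𝕜) • yosida R d) x‖ ≤
      M ^ 2 * Real.exp (2 * w * s) * s * ‖yosida R c x - yosida R d x‖ := by
  have hw := hR.pos
  exact norm_exp_sub_exp_le (hR.commute_yosida (by linarith) (by linarith)) (by linarith)
    (hR.norm_exp_yosida_le hc) (hR.norm_exp_yosida_le hd) s x

theorem exists_tendsto_exp_yosida (hR : IsResolventOf R G M w) (s : ℝ≥0) :
    ∃ S : X →L[𝕜] X, ‖S‖ ≤ M * Real.exp (2 * w * s) ∧ ∀ x,
      Tendsto (fun c => NormedSpace.exp (((s : ℝ) : 𝕜) • yosida R c) x) atTop (𝓝 (S x)) := by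
  have hM := hR.one_le
  refine exists_strong_limit (l := (atTop : Filter ℝ))
    ((eventually_ge_atTop (2 * w)).mono fun c hc => hR.norm_exp_yosida_le hc s) hR.dense ?_
  rintro x ⟨z, hxz⟩
  rw [Metric.cauchy_iff]
  refine ⟨inferInstance, fun ε hε => ?_⟩
  set K := M ^ 2 * Real.exp (2 * w * s) * s + 1 with hK
  have hKpos : 0 < K := by positivity
  obtain ⟨t, ht, ht'⟩ := (Metric.cauchy_iff.1 (hR.tendsto_yosida hxz).cauchy_map).2 (ε / K)
    (by positivity)
  refine ⟨_, image_mem_map (inter_mem ht (eventually_ge_atTop (2 * w))), ?_⟩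
  rintro _ ⟨c, ⟨hc, hc'⟩, rfl⟩ _ ⟨d, ⟨hd, hd'⟩, rfl⟩
  have h1 := ht' _ hc _ hd
  rw [dist_eq_norm] at h1 ⊢
  calc _ ≤ M ^ 2 * Real.exp (2 * w * s) * s * ‖yosida R c x - yosida R d x‖ :=
        hR.norm_exp_yosida_sub_le hc' hd' s x
    _ ≤ K * ‖yosida R c x - yosida R d x‖ := by
        gcongr; rw [hK]; linarith
    _ < K * (ε / K) := by gcongr
    _ = ε := by field_simp

/-- **Hille–Yosida theorem**: an operator with the resolvent bounds generates a `C₀`-semigroup. -/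
theorem exists_isC0Semigroup (hR : IsResolventOf R G M w) :
    ∃ T : ℝ≥0 → X →L[𝕜] X, IsC0Semigroup T ∧
      ∀ x z, HasStrongDerivAtZero T x z ↔ (x, z) ∈ G := by
  choose T hTb hT using hR.exists_tendsto_exp_yosida
  have hw := hR.pos
  have hM := hR.one_le
  have hcomp : ∀ (s : ℝ≥0) {x z : X}, (x, z) ∈ G → ∀ c : ℝ, 2 * w ≤ c →
      ‖NormedSpace.exp (((s : ℝ) : 𝕜) • yosida R c) x - T s x‖ ≤
        M ^ 2 * Real.exp (2 * w * s) * s * ‖yosida R c x - z‖ := by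
    intro s x z hxz c hc
    have h1 := ((hT s x).const_sub (NormedSpace.exp (((s : ℝ) : 𝕜) • yosida R c) x)).norm
    have h2 := ((hR.tendsto_yosida hxz).const_sub (yosida R c x)).norm.const_mul
      (M ^ 2 * Real.exp (2 * w * s) * s)
    refine le_of_tendsto_of_tendsto h1 h2 ?_
    filter_upwards [eventually_ge_atTop (2 * w)] with d hd
    exact hR.norm_exp_yosida_sub_le hc hd s x
  have hT0 : T 0 = ContinuousLinearMap.id 𝕜 X := by
    ext x
    refine tendsto_nhds_unique (hT 0 x) ?_
    simp
  have hTadd : ∀ l m : ℝ≥0, T (l + m) = (T l).comp (T m) := by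
    intro l m
    ext x
    refine tendsto_nhds_unique (hT (l + m) x) ?_
    have h1 := tendsto_apply_apply
      (T := fun c : ℝ => NormedSpace.exp (((l : ℝ) : 𝕜) • yosida R c))
      ((eventually_ge_atTop (2 * w)).mono fun c hc => hR.norm_exp_yosida_le hc l)
      (hT m x) (hT l (T m x))
    refine h1.congr fun c => ?_
    have : (((l + m : ℝ≥0) : ℝ) : 𝕜) • yosida R c =
        ((l : ℝ) : 𝕜) • yosida R c + ((m : ℝ) : 𝕜) • yosida R c := by
      push_cast; module
    rw [this, exp_add_of_commute_clm (((Commute.refl _).smul_left _).smul_right _)]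
    rfl
  have hderiv : ∀ {x z : X}, (x, z) ∈ G → HasStrongDerivAtZero T x z := by
    intro x z hxz
    rw [HasStrongDerivAtZero, hT0, Metric.tendsto_nhds]
    intro ε hε
    set K := M ^ 2 * Real.exp (2 * w) + 1 with hK
    have hKpos : 0 < K := by positivity
    obtain ⟨c, hc, hc'⟩ := ((eventually_ge_atTop (2 * w)).and (Metric.tendsto_nhds.1
      (hR.tendsto_yosida hxz) (ε / (2 * K)) (by positivity))).exists
    rw [dist_eq_norm] at hc'
    have h1 : Tendsto (fun h : ℝ≥0 => ((((h : ℝ) : 𝕜)⁻¹) •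
      (NormedSpace.exp (((h : ℝ) : 𝕜) • yosida R c) - 1)) x) (𝓝[≠] 0) (𝓝 (yosida R c x)) :=
      (((ContinuousLinearMap.apply 𝕜 X x).continuous.tendsto _).comp
        (tendsto_exp_slope_zero (yosida R c)))
    have h2 : ∀ᶠ h : ℝ≥0 in 𝓝[≠] 0, h ≤ 1 :=
      nhdsWithin_le_nhds (eventually_le_nhds (by norm_num))
    filter_upwards [Metric.tendsto_nhds.1 h1 (ε / 2) (by positivity), h2, self_mem_nhdsWithin]
      with h hh hh1 hh0
    have hpos : 0 < (h : ℝ) := by exact_mod_cast pos_iff_ne_zero.2 hh0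
    rw [dist_eq_norm] at hh ⊢
    simp only [_root_.smul_apply, _root_.sub_apply, one_apply_eq_self,
      ContinuousLinearMap.id_apply] at hh ⊢
    have h3 := hcomp h hxz c hc
    set E := NormedSpace.exp (((h : ℝ) : 𝕜) • yosida R c) x with hE
    have e : (((h : ℝ) : 𝕜)⁻¹) • (T h x - x) - z =
        ((((h : ℝ) : 𝕜)⁻¹) • (E - x) - yosida R c x) +
          ((yosida R c x - z) - (((h : ℝ) : 𝕜)⁻¹) • (E - T h x)) := by
      module
    have h4 : ‖(((h : ℝ) : 𝕜)⁻¹) • (E - T h x)‖ ≤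
        M ^ 2 * Real.exp (2 * w) * ‖yosida R c x - z‖ := by
      rw [norm_smul, norm_inv, RCLike.norm_ofReal, abs_of_pos hpos, inv_mul_le_iff₀ hpos]
      refine h3.trans ?_
      have h5 : Real.exp (2 * w * h) ≤ Real.exp (2 * w) := by
        have : (h : ℝ) ≤ 1 := by exact_mod_cast hh1
        exact Real.exp_le_exp.2 (by nlinarith)
      calc M ^ 2 * Real.exp (2 * w * h) * h * ‖yosida R c x - z‖
          ≤ M ^ 2 * Real.exp (2 * w) * h * ‖yosida R c x - z‖ := by gcongr
        _ = _ := by ring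
    have h6 : K * ‖yosida R c x - z‖ < ε / 2 := by
      calc _ < K * (ε / (2 * K)) := by gcongr
        _ = ε / 2 := by field_simp
    rw [e]
    calc _ ≤ _ + _ := norm_add_le _ _
      _ ≤ _ + (‖yosida R c x - z‖ + ‖(((h : ℝ) : 𝕜)⁻¹) • (E - T h x)‖) :=
          add_le_add_right (norm_sub_le _ _) _
      _ < ε := by rw [hK] at h6; linarith
  have hcomm : ∀ c, w < c → ∀ s x, R c (T s x) = T s (R c x) := by
    intro c hc s x
    refine tendsto_nhds_unique (((R c).continuous.tendsto _).comp (hT s x)) ?_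
    refine (hT s (R c x)).congr' ?_
    filter_upwards [eventually_gt_atTop w] with d hd
    have : Commute (R c) (NormedSpace.exp (((s : ℝ) : 𝕜) • yosida R d)) :=
      ((hR.commute_yosida_right hc hd).smul_right _).exp_right
    exact (congrArg (fun A : X →L[𝕜] X => A x) this.eq).symm
  refine ⟨T, ⟨hT0, hTadd, ?_, ⟨M + 1, 2 * w, by linarith, fun s => ?_⟩⟩, fun x z => ⟨?_, hderiv⟩⟩
  · intro x
    rw [continuous_iff_continuousAt]
    intro s₀
    have hloc : ∀ᶠ s : ℝ≥0 in 𝓝 s₀, ‖T s‖ ≤ M * Real.exp (2 * w * (s₀ + 1)) := by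
      filter_upwards [eventually_le_nhds (lt_add_one s₀)] with s hs
      refine (hTb s).trans ?_
      have : (s : ℝ) ≤ s₀ + 1 := by exact_mod_cast hs
      gcongr
    refine tendsto_apply_of_dense (l := 𝓝 s₀) hloc hR.dense ?_ x
    rintro x ⟨z, hxz⟩
    have hunif : TendstoLocallyUniformly
        (fun (c : ℝ) (s : ℝ≥0) => NormedSpace.exp (((s : ℝ) : 𝕜) • yosida R c) x)
        (fun s => T s x) atTop := by
      rw [Metric.tendstoLocallyUniformly_iff]
      intro ε hε s
      set K := M ^ 2 * Real.exp (2 * w * (s + 1)) * (s + 1) with hK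
      have hKpos : 0 < K := by positivity
      refine ⟨{r | r ≤ s + 1}, eventually_le_nhds (lt_add_one s), ?_⟩
      filter_upwards [eventually_ge_atTop (2 * w), Metric.tendsto_nhds.1 (hR.tendsto_yosida hxz)
        (ε / K) (by positivity)] with c hc hc' r hr
      have hr' : (r : ℝ) ≤ s + 1 := by exact_mod_cast hr
      rw [dist_eq_norm] at hc'
      rw [dist_comm, dist_eq_norm]
      calc _ ≤ _ := hcomp r hxz c hc
        _ ≤ K * ‖yosida R c x - z‖ := by rw [hK]; gcongr
        _ < K * (ε / K) := by gcongr
        _ = ε := by field_simp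
    refine (hunif.continuous (Eventually.frequently (Eventually.of_forall fun c => ?_))).tendsto s₀
    have h1 : Continuous fun u : 𝕜 => NormedSpace.exp (u • yosida R c) :=
      continuous_iff_continuousAt.2 fun u =>
        (hasDerivAt_exp_smul_const (yosida R c) u).continuousAt
    exact ((ContinuousLinearMap.apply 𝕜 X x).continuous.comp h1).comp
      (RCLike.continuous_ofReal.comp NNReal.continuous_coe)
  · refine (hTb s).trans ?_
    gcongr
    linarith
  · intro hxz
    have hc : w < w + 1 := lt_add_one w
    have h1 : HasStrongDerivAtZero T (R (w + 1) x) (R (w + 1) z) := by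
      have := ((R (w + 1)).continuous.tendsto _).comp hxz
      refine this.congr fun h => ?_
      simp only [Function.comp_apply, map_smul, map_sub, hcomm _ hc]
    have h2 := h1.unique (hderiv (hR.apply_mem hc x))
    rw [hR.mem_iff _ hc, map_sub, map_smul, h2, sub_sub_cancel]

end IsResolventOf

end HilleYosida

section DiscreteResolvent

variable {𝕜 X : Type*} [RCLike 𝕜] [NormedAddCommGroup X] [NormedSpace 𝕜 X]

/-- The bounded approximation `(F h - 1) / h` of the derivative of `F` at `0`. -/
noncomputable def differenceQuotient (F : ℝ≥0 → X →L[𝕜] X) (h : ℝ≥0) : X →L[𝕜] X :=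
  (((h : ℝ) : 𝕜)⁻¹) • (F h - 1)

/-- The resolvent at `c` of the difference quotient. -/
noncomputable def discreteResolvent (F : ℝ≥0 → X →L[𝕜] X) (c : ℝ) (h : ℝ≥0) : X →L[𝕜] X :=
  Ring.inverse ((c : 𝕜) • 1 - differenceQuotient F h)

variable {F : ℝ≥0 → X →L[𝕜] X} {M a c : ℝ}

theorem tendsto_differenceQuotient (h0 : F 0 = ContinuousLinearMap.id 𝕜 X) {x z : X}
    (hx : HasStrongDerivAtZero F x z) :
    Tendsto (fun h => differenceQuotient F h x) (𝓝[≠] 0) (𝓝 z) := by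
  refine hx.congr fun h => ?_
  simp [differenceQuotient, h0]

theorem apply_eq_add_differenceQuotient {h : ℝ≥0} (hh : h ≠ 0) (x : X) :
    F h x = x + ((h : ℝ) : 𝕜) • differenceQuotient F h x := by
  have : ((h : ℝ) : 𝕜) ≠ 0 := by simpa using hh
  simp [differenceQuotient, smul_smul, mul_inv_cancel₀ this]

theorem eventually_small (a : ℝ) : ∀ᶠ h : ℝ≥0 in 𝓝[≠] 0, 0 < h ∧ a * h ≤ 1 := by
  have h1 : ∀ᶠ h : ℝ≥0 in 𝓝 0, a * (h : ℝ) < 1 := by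
    have : Tendsto (fun h : ℝ≥0 => a * (h : ℝ)) (𝓝 0) (𝓝 (a * ((0 : ℝ≥0) : ℝ))) :=
      (NNReal.continuous_coe.tendsto 0).const_mul a
    exact this.eventually_lt_const (by simp)
  filter_upwards [nhdsWithin_le_nhds h1, self_mem_nhdsWithin] with h hh hh'
  exact ⟨pos_iff_ne_zero.2 hh', hh.le⟩

variable [CompleteSpace X]

theorem discreteResolvent_spec (hM : 1 ≤ M) (ha : 0 < a)
    (hF : ∀ (h : ℝ≥0) (k : ℕ), ‖F h ^ k‖ ≤ M * Real.exp (a * k * h)) (hc : 2 * a < c)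
    {h : ℝ≥0} (hh : 0 < h) (hah : a * h ≤ 1) :
    ((c : 𝕜) • 1 - differenceQuotient F h) * discreteResolvent F c h = 1 ∧
    discreteResolvent F c h * ((c : 𝕜) • 1 - differenceQuotient F h) = 1 ∧
    ∀ j, ‖discreteResolvent F c h ^ j‖ ≤ M * ((c - 2 * a)⁻¹) ^ j := by
  have hh' : 0 < (h : ℝ) := by exact_mod_cast hh
  have hhk : ((h : ℝ) : 𝕜) ≠ 0 := by exact_mod_cast hh'.ne'
  have hexp : Real.exp (a * h) ≤ 1 + 2 * (a * h) := by
    have h0 : 0 ≤ a * (h : ℝ) := by positivity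
    have := Real.abs_exp_sub_one_le (x := a * h) (by rwa [abs_of_nonneg h0])
    rw [abs_of_nonneg h0] at this
    linarith [le_abs_self (Real.exp (a * h) - 1)]
  have hlow : (c - 2 * a) * h ≤ 1 + c * h - Real.exp (a * h) := by linarith
  have hpos : 0 < (c - 2 * a) * h := mul_pos (by linarith) hh'
  obtain ⟨R, h1, h2, h3⟩ := exists_inverse_of_pow_bound (F h) (M := M) (b := Real.exp (a * h))
    (c := 1 + c * h) (Real.exp_pos _).le (by linarith) (fun k => by
      rw [← Real.exp_nat_mul]
      convert hF h k using 3
      ring)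
  have e : (((1 + c * h : ℝ) : 𝕜) • (1 : X →L[𝕜] X) - F h) =
      ((h : ℝ) : 𝕜) • ((c : 𝕜) • 1 - differenceQuotient F h) := by
    rw [differenceQuotient, smul_sub, smul_smul, smul_smul, mul_inv_cancel₀ hhk]
    push_cast
    module
  rw [e] at h1 h2
  have h1' : ((c : 𝕜) • 1 - differenceQuotient F h) * (((h : ℝ) : 𝕜) • R) = 1 := by
    rw [mul_smul_comm, ← smul_mul_assoc, h1]
  have h2' : (((h : ℝ) : 𝕜) • R) * ((c : 𝕜) • 1 - differenceQuotient F h) = 1 := by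
    rw [smul_mul_assoc, ← mul_smul_comm, h2]
  have hR : discreteResolvent F c h = ((h : ℝ) : 𝕜) • R :=
    Ring.inverse_unit (⟨_, _, h1', h2'⟩ : (X →L[𝕜] X)ˣ)
  rw [hR]
  refine ⟨h1', h2', fun j => ?_⟩
  rw [smul_pow, norm_smul, norm_pow, RCLike.norm_ofReal, NNReal.abs_eq]
  calc _ ≤ (h : ℝ) ^ j * (M * ((1 + c * h - Real.exp (a * h))⁻¹) ^ j) := by gcongr; exact h3 j
    _ ≤ (h : ℝ) ^ j * (M * (((c - 2 * a) * h)⁻¹) ^ j) := by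
        gcongr
        exact inv_nonneg.2 (hpos.le.trans hlow)
    _ = _ := by
        rw [mul_inv, mul_pow, inv_pow (h : ℝ) j]
        field_simp

theorem eventually_norm_discreteResolvent_le (hM : 1 ≤ M) (ha : 0 < a)
    (hF : ∀ (h : ℝ≥0) (k : ℕ), ‖F h ^ k‖ ≤ M * Real.exp (a * k * h)) (hc : 2 * a < c) :
    ∀ᶠ h : ℝ≥0 in 𝓝[≠] 0, ‖discreteResolvent F c h‖ ≤ M * (c - 2 * a)⁻¹ := by
  filter_upwards [eventually_small a] with h hh
  simpa using (discreteResolvent_spec hM ha hF hc hh.1 hh.2).2.2 1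

theorem tendsto_discreteResolvent_sub (h0 : F 0 = ContinuousLinearMap.id 𝕜 X) (hM : 1 ≤ M)
    (ha : 0 < a) (hF : ∀ (h : ℝ≥0) (k : ℕ), ‖F h ^ k‖ ≤ M * Real.exp (a * k * h))
    (hc : 2 * a < c) {x z : X} (hx : HasStrongDerivAtZero F x z) :
    Tendsto (fun h => discreteResolvent F c h ((c : 𝕜) • x - z)) (𝓝[≠] 0) (𝓝 x) := by
  have hb := eventually_norm_discreteResolvent_le hM ha hF hc
  have h1 : Tendsto (fun h => discreteResolvent F c h (differenceQuotient F h x - z))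
      (𝓝[≠] 0) (𝓝 0) := by
    refine tendsto_apply_apply hb (x := 0) ?_ (by simp)
    simpa using (tendsto_differenceQuotient h0 hx).sub_const z
  refine (by simpa using h1.add_const x : Tendsto _ _ (𝓝 x)).congr' ?_
  filter_upwards [eventually_small a] with h hh
  have e := congrArg (fun A : X →L[𝕜] X => A x) (discreteResolvent_spec hM ha hF hc hh.1 hh.2).2.1
  simp only [mul_apply_eq_comp, _root_.sub_apply, _root_.smul_apply, one_apply_eq_self,
    map_sub] at e ⊢
  rw [sub_eq_iff_eq_add.1 e]
  abel

/-- If the range of `c - Z` is dense for large `c`, then the discrete resolvents converge to the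
resolvent of the closure of `Z`. -/
theorem exists_isResolventOf (h0 : F 0 = ContinuousLinearMap.id 𝕜 X) (hM : 1 ≤ M)
    (ha : 0 < a) (hF : ∀ (h : ℝ≥0) (k : ℕ), ‖F h ^ k‖ ≤ M * Real.exp (a * k * h))
    {Z : X →ₗ.[𝕜] X} (hZ : Dense (Z.domain : Set X)) (hZF : Z ≤ strongDeriv F)
    (hrange : ∀ c : ℝ, 2 * a < c →
      Dense (Set.range fun x : Z.domain => (c : 𝕜) • (x : X) - Z x)) :
    ∃ R : ℝ → X →L[𝕜] X, IsResolventOf R Z.graph.topologicalClosure M (2 * a) ∧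
      ∀ c, 2 * a < c → ∀ x,
        Tendsto (fun h => discreteResolvent F c h x) (𝓝[≠] 0) (𝓝 (R c x)) := by
  have hne := neBot_nhdsNE_zero
  have hderiv : ∀ x : Z.domain, HasStrongDerivAtZero F (x : X) (Z x) := by
    intro x
    have h1 := strongDeriv_apply F ⟨x, hZF.1 x.2⟩
    rwa [← hZF.2 (x := x) (y := ⟨x, hZF.1 x.2⟩) rfl] at h1
  have hex : ∀ c : ℝ, ∃ S : X →L[𝕜] X, 2 * a < c → ∀ x,
      Tendsto (fun h => discreteResolvent F c h x) (𝓝[≠] 0) (𝓝 (S x)) := by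
    intro c
    by_cases hc : 2 * a < c
    · obtain ⟨S, -, hS⟩ := exists_strong_limit
        (eventually_norm_discreteResolvent_le hM ha hF hc) (hrange c hc) (by
          rintro _ ⟨x, rfl⟩
          exact (tendsto_discreteResolvent_sub h0 hM ha hF hc (hderiv x)).cauchy_map)
      exact ⟨S, fun _ => hS⟩
    · exact ⟨0, fun h => absurd h hc⟩
  choose R hR using hex
  have hRZ : ∀ c, 2 * a < c → ∀ x : Z.domain, R c ((c : 𝕜) • (x : X) - Z x) = x := fun c hc x =>
    tendsto_nhds_unique (hR c hc _) (tendsto_discreteResolvent_sub h0 hM ha hF hc (hderiv x))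
  refine ⟨R, ⟨hM, by linarith, ?_, ?_, ?_⟩, hR⟩
  · intro c hc x z
    rw [← SetLike.mem_coe, Submodule.topologicalClosure_coe]
    constructor
    · intro h
      have hcl : IsClosed {p : X × X | R c ((c : 𝕜) • p.1 - p.2) = p.1} :=
        isClosed_eq (by fun_prop) (by fun_prop)
      refine closure_minimal ?_ hcl h
      rintro ⟨y, y'⟩ hy
      obtain ⟨w, hw1, hw2⟩ := (LinearPMap.mem_graph_iff _).1 hy
      simp only at hw1 hw2
      subst hw1 hw2
      exact hRZ c hc w
    · intro h
      have hcont : Continuous fun y : X => (R c y, (c : 𝕜) • R c y - y) := by fun_prop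
      have := map_mem_closure hcont (hrange c hc ((c : 𝕜) • x - z))
        (t := (Z.graph : Set (X × X))) (by
          rintro _ ⟨w, rfl⟩
          simp only [hRZ c hc w, sub_sub_cancel]
          exact Z.mem_graph w)
      simpa only [h, sub_sub_cancel] using this
  · intro c hc j
    have hlim : ∀ x, Tendsto (fun h => (discreteResolvent F c h ^ j) x) (𝓝[≠] 0)
        (𝓝 ((R c ^ j) x)) := by
      induction j with
      | zero => intro x; simp
      | succ j ih =>
        intro x
        simp only [pow_succ', mul_apply_eq_comp]
        exact tendsto_apply_apply (eventually_norm_discreteResolvent_le hM ha hF hc) (ih x)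
          (hR c hc _)
    have : 0 ≤ (c - 2 * a)⁻¹ := inv_nonneg.2 (by linarith)
    refine ContinuousLinearMap.opNorm_le_bound _ (by positivity) fun x => ?_
    refine le_of_tendsto (hlim x).norm ?_
    filter_upwards [eventually_small a] with h hh
    exact norm_apply_le_of_le ((discreteResolvent_spec hM ha hF hc hh.1 hh.2).2.2 j) x
  · refine hZ.mono fun x hx => ?_
    exact ⟨Z ⟨x, hx⟩, Submodule.le_topologicalClosure _ (Z.mem_graph ⟨x, hx⟩)⟩

end DiscreteResolvent

section ProductFormula

variable {𝕜 X : Type*} [RCLike 𝕜] [NormedAddCommGroup X] [NormedSpace 𝕜 X]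

theorem norm_pow_apply_sub_le {B : X →L[𝕜] X} {C δ : ℝ} :
    ∀ (n : ℕ) (x : ℕ → X), (∀ k ≤ n, ‖B ^ k‖ ≤ C) → (∀ k < n, ‖B (x k) - x (k + 1)‖ ≤ δ) →
      ‖(B ^ n) (x 0) - x n‖ ≤ n * (C * δ)
  | 0, x, _, _ => by simp
  | n + 1, x, hB, hx => by
    have ih := norm_pow_apply_sub_le (B := B) (C := C) (δ := δ) n (fun k => x (k + 1))
      (fun k hk => hB k (hk.trans n.le_succ)) fun k hk => hx (k + 1) (Nat.succ_lt_succ hk)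
    have h1 := hx 0 n.succ_pos
    have h2 : ‖(B ^ n) (B (x 0) - x 1)‖ ≤ C * δ :=
      (norm_apply_le_of_le (hB n n.le_succ) _).trans
        (mul_le_mul_of_nonneg_left h1 ((norm_nonneg _).trans (hB n n.le_succ)))
    have e : (B ^ (n + 1)) (x 0) - x (n + 1) =
        (B ^ n) (B (x 0) - x 1) + ((B ^ n) (x 1) - x (n + 1)) := by
      rw [pow_succ, mul_apply_eq_comp, map_sub]; abel
    rw [e]
    calc _ ≤ _ := norm_add_le _ _
      _ ≤ C * δ + n * (C * δ) := add_le_add h2 ih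
      _ = _ := by push_cast; ring

theorem IsC0Semigroup.apply_comm {T : ℝ≥0 → X →L[𝕜] X} (hT : IsC0Semigroup T) (r s : ℝ≥0)
    (x : X) : T r (T s x) = T s (T r x) := by
  have h1 := congrArg (fun A : X →L[𝕜] X => A x) (hT.map_add s r)
  have h2 := congrArg (fun A : X →L[𝕜] X => A x) (hT.map_add r s)
  simp only [ContinuousLinearMap.comp_apply] at h1 h2
  rw [← h1, ← h2, add_comm]

theorem IsC0Semigroup.hasStrongDerivAtZero_apply {T : ℝ≥0 → X →L[𝕜] X} (hT : IsC0Semigroup T)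
    {x z : X} (h : HasStrongDerivAtZero T x z) (r : ℝ≥0) :
    HasStrongDerivAtZero T (T r x) (T r z) := by
  refine (((T r).continuous.tendsto _).comp h).congr fun s => ?_
  simp [hT.map_zero, hT.apply_comm s r]

variable [CompleteSpace X] {F : ℝ≥0 → X →L[𝕜] X} {M a : ℝ}

/-- **Chernoff's product formula** along discrete resolvents converging to the resolvent of the
generator. -/
theorem tendsto_pow_apply_of_isResolventOf (hM : 1 ≤ M) (ha : 0 < a)
    (hF : ∀ (h : ℝ≥0) (k : ℕ), ‖F h ^ k‖ ≤ M * Real.exp (a * k * h))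
    {R : ℝ → X →L[𝕜] X} {G : Submodule 𝕜 (X × X)} (hR : IsResolventOf R G M (2 * a))
    (hlim : ∀ c, 2 * a < c → ∀ x,
      Tendsto (fun h => discreteResolvent F c h x) (𝓝[≠] 0) (𝓝 (R c x)))
    {T : ℝ≥0 → X →L[𝕜] X} (hT : IsC0Semigroup T)
    (hTG : ∀ x z, HasStrongDerivAtZero T x z ↔ (x, z) ∈ G) {s : ℝ≥0} (hs : 0 < s) (f : X) :
    Tendsto (fun n : ℕ => (F (s / n) ^ n) f) atTop (𝓝 (T s f)) := by
  set c := 2 * a + 1 with hcdef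
  have hc : 2 * a < c := by rw [hcdef]; linarith
  have hstep := tendsto_div_nat_nhdsNE hs
  have hFb : ∀ᶠ n : ℕ in atTop, ‖F (s / n) ^ n‖ ≤ M * Real.exp (a * s) := by
    filter_upwards [eventually_gt_atTop 0] with n hn
    have hn' : (n : ℝ) ≠ 0 := by positivity
    refine (hF _ _).trans_eq ?_
    push_cast
    congr 2
    field_simp
  obtain ⟨M', a', -, hT'⟩ := hT.bound
  have hTb : ∃ C, 0 < C ∧ ∀ r ≤ s, ‖T r‖ ≤ C := by
    refine ⟨|M'| * Real.exp (|a'| * s) + 1, by positivity, fun r hr => (hT' r).trans ?_⟩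
    have h1 : a' * r ≤ |a'| * s := by
      have : (r : ℝ) ≤ s := by exact_mod_cast hr
      exact (mul_le_mul_of_nonneg_right (le_abs_self a') r.2).trans
        (mul_le_mul_of_nonneg_left this (abs_nonneg _))
    have h2 := mul_le_mul (le_abs_self M') (Real.exp_le_exp.2 h1) (Real.exp_pos _).le (abs_nonneg _)
    linarith
  obtain ⟨C, hC, hTC⟩ := hTb
  set K := M * (c - 2 * a)⁻¹ with hK
  have hKM : K = M := by rw [hK, hcdef]; simp
  have hKpos : 0 < K := by rw [hKM]; linarith
  have hRb := eventually_norm_discreteResolvent_le hM ha hF hc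
  have key : ∀ g z, (g, z) ∈ G →
      Tendsto (fun n : ℕ => (F (s / n) ^ n) (R c g)) atTop (𝓝 (T s (R c g))) := by
    intro g z hgz
    set y := (c : 𝕜) • g - z with hy
    have hRT : ∀ r, R c (T r y) = T r g := by
      intro r
      have := (hTG _ _).1 (hT.hasStrongDerivAtZero_apply ((hTG g z).2 hgz) r)
      have := (hR.mem_iff c hc _ _).1 this
      rwa [← map_smul, ← map_sub] at this
    have hTR : R c (T s g) = T s (R c g) := by
      have := (hTG _ _).1 (hT.hasStrongDerivAtZero_apply ((hTG _ _).2 (hR.apply_mem hc g)) s)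
      have := (hR.mem_iff c hc _ _).1 this
      rwa [← map_smul, ← map_sub, sub_sub_cancel] at this
    have hD : Tendsto (fun n : ℕ => (F (s / n) ^ n) (discreteResolvent F c (s / n) g) -
        discreteResolvent F c (s / n) (T s g)) atTop (𝓝 0) := by
      rw [Metric.tendsto_nhds]
      intro ε hε
      set L := s * (M * Real.exp (a * s)) * (1 + K * C) + 1 with hL
      have hLpos : 0 < L := by positivity
      have hcomp : IsCompact ((fun r => T r y) '' Set.Icc 0 s) :=
        isCompact_Icc.image (hT.continuous y)
      have h1 := eventually_forall_norm_sub_lt_of_isCompact hRb (hlim c hc) hcomp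
        (ε := ε / L) (by positivity)
      have h2 := Metric.tendsto_nhds.1 ((hTG g z).2 hgz) (ε / L) (by positivity)
      filter_upwards [hstep.eventually h1, hstep.eventually h2, hstep.eventually hRb,
        hstep.eventually (eventually_small a), eventually_gt_atTop 0] with n h1 h2 h3 h4 hn
      have hn' : (n : ℝ) ≠ 0 := by positivity
      set h : ℝ≥0 := s / n with hh
      have hnh : (n : ℝ≥0) * h = s := by rw [hh]; field_simp
      set zh := (((h : ℝ) : 𝕜)⁻¹) • (T h g - T 0 g) with hzh
      have hhk : ((h : ℝ) : 𝕜) ≠ 0 := by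
        have := h4.1.ne'
        exact_mod_cast this
      have hTh : T h g = g + ((h : ℝ) : 𝕜) • zh := by
        rw [hzh, smul_smul, mul_inv_cancel₀ hhk, hT.map_zero]; simp
      rw [dist_eq_norm] at h2
      have hb := norm_pow_apply_sub_le (B := F h) (C := M * Real.exp (a * s))
        (δ := h * (ε / L * (1 + K * C))) n
        (fun k => discreteResolvent F c h (T (k * h) g)) ?_ ?_
      · simp only [Nat.cast_zero, zero_mul, hT.map_zero, hnh, ContinuousLinearMap.id_apply] at hb
        rw [dist_zero_right]
        have hnh' : (n : ℝ) * h = s := by exact_mod_cast hnh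
        calc _ ≤ _ := hb
          _ = (n * h) * (M * Real.exp (a * s)) * (1 + K * C) * (ε / L) := by ring
          _ = (L - 1) * (ε / L) := by rw [hnh', hL]; ring
          _ < L * (ε / L) := by gcongr; linarith
          _ = ε := by field_simp
      · intro k hk
        refine (hF h k).trans ?_
        have h5 : (k : ℝ) * h ≤ s := by
          have : (k : ℝ≥0) * h ≤ s := by
            rw [← hnh]; gcongr
          exact_mod_cast this
        have : a * k * h ≤ a * s := by
          rw [mul_assoc]; gcongr
        gcongr
      · intro k hk
        have hks : (k : ℝ≥0) * h ≤ s := by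
          rw [← hnh]; gcongr
        have e1 := congrArg (fun A : X →L[𝕜] X => A (T (k * h) g))
          (discreteResolvent_spec hM ha hF hc h4.1 h4.2).1
        simp only [mul_apply_eq_comp, _root_.sub_apply, _root_.smul_apply,
          one_apply_eq_self] at e1
        have e1' : differenceQuotient F h (discreteResolvent F c h (T (k * h) g)) =
            (c : 𝕜) • discreteResolvent F c h (T (k * h) g) - T (k * h) g :=
          eq_sub_of_add_eq' (sub_eq_iff_eq_add.1 e1).symm
        have e2 : T ((k + 1 : ℕ) * h) g = T (k * h) g + ((h : ℝ) : 𝕜) • T (k * h) zh := by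
          have : ((k + 1 : ℕ) : ℝ≥0) * h = k * h + h := by push_cast; ring
          rw [this, hT.map_add, ContinuousLinearMap.comp_apply, hTh, map_add, map_smul]
        have e3 : F h (discreteResolvent F c h (T (k * h) g)) -
            discreteResolvent F c h (T ((k + 1 : ℕ) * h) g) = ((h : ℝ) : 𝕜) •
            ((discreteResolvent F c h (T (k * h) y) - R c (T (k * h) y)) -
              discreteResolvent F c h (T (k * h) (zh - z))) := by
          rw [e2, hRT, apply_eq_add_differenceQuotient h4.1.ne', hy]
          rw [e1']
          simp only [map_sub, map_add, map_smul]
          module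
        rw [e3, norm_smul, RCLike.norm_ofReal, NNReal.abs_eq]
        gcongr
        calc _ ≤ _ := norm_sub_le _ _
          _ ≤ ε / L + K * (C * ‖zh - z‖) := by
            refine add_le_add (h1 _ ⟨_, ⟨zero_le, hks⟩, rfl⟩).le ?_
            refine (norm_apply_le_of_le h3 _).trans ?_
            gcongr
            exact norm_apply_le_of_le (hTC _ hks) _
          _ ≤ ε / L + K * (C * (ε / L)) := by gcongr
          _ = _ := by ring
    have hA : Tendsto (fun n : ℕ => (F (s / n) ^ n) (R c g - discreteResolvent F c (s / n) g))
        atTop (𝓝 0) := by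
      refine tendsto_apply_apply (T := fun n : ℕ => F (s / n) ^ n) hFb (x := 0) ?_ (by simp)
      simpa using ((hlim c hc g).comp hstep).const_sub (R c g)
    have hB := (hlim c hc (T s g)).comp hstep
    rw [hTR] at hB
    refine (by simpa using (hA.add hD).add hB : Tendsto _ _ (𝓝 (T s (R c g)))).congr fun n => ?_
    simp
  refine tendsto_apply_of_dense (T := fun n : ℕ => F (s / n) ^ n) (S := T s) hFb
    (D := R c '' {x | ∃ z, (x, z) ∈ G}) ?_ ?_ f
  · have h1 : Dense (Set.range (R c)) := by
      refine hR.dense.mono ?_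
      rintro x ⟨z, hz⟩
      exact ⟨_, (hR.mem_iff c hc x z).1 hz⟩
    intro x
    have h2 : Set.range (R c) ⊆ closure (R c '' {x | ∃ z, (x, z) ∈ G}) := by
      rw [← Set.image_univ, ← hR.dense.closure_eq]
      exact image_closure_subset_closure_image (R c).continuous
    exact closure_minimal h2 isClosed_closure (h1 x)
  · rintro _ ⟨g, ⟨z, hz⟩, rfl⟩
    exact key g z hz

end ProductFormula

section Duality

variable {𝕜 X : Type*} [RCLike 𝕜] [NormedAddCommGroup X] [NormedSpace 𝕜 X]

/-- Weak convergence of a sequence, tested on functionals. -/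
def WeaklyTendsto (𝕜 : Type*) {X : Type*} [RCLike 𝕜] [NormedAddCommGroup X] [NormedSpace 𝕜 X]
    (u : ℕ → X) (x : X) : Prop :=
  ∀ φ : StrongDual 𝕜 X, Tendsto (fun k => φ (u k)) atTop (𝓝 (φ x))

theorem weaklyTendsto_of_tendsto_toWeakSpace {u : ℕ → X} {x : X}
    (h : Tendsto (fun k => toWeakSpace 𝕜 X (u k)) atTop (𝓝 (toWeakSpace 𝕜 X x))) :
    WeaklyTendsto 𝕜 u x :=
  fun φ => ((WeakBilin.eval_continuous (topDualPairing 𝕜 X).flip φ).tendsto _).comp h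

theorem eq_zero_of_forall_dual_apply_eq_zero {x : X} (h : ∀ φ : StrongDual 𝕜 X, φ x = 0) :
    x = 0 := by
  obtain ⟨g, -, hg⟩ := exists_dual_vector'' 𝕜 x
  rw [h g] at hg
  exact norm_eq_zero.1 (by exact_mod_cast hg.symm)

/-- A weak-* dense set of functionals separates points. -/
theorem WeakStarDense.eq_zero {D : Set (StrongDual 𝕜 X)} (hD : WeakStarDense D) {x : X}
    (h : ∀ φ ∈ D, φ x = 0) : x = 0 := by
  refine eq_zero_of_forall_dual_apply_eq_zero (𝕜 := 𝕜) fun φ => ?_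
  have hcl : IsClosed {ψ : WeakDual 𝕜 X | ψ x = 0} :=
    isClosed_eq (WeakDual.eval_continuous x) continuous_const
  have := closure_minimal (s := StrongDual.toWeakDual '' D) (by
    rintro _ ⟨ψ, hψ, rfl⟩
    exact h ψ hψ) hcl (hD (StrongDual.toWeakDual φ))
  exact this

theorem norm_le_of_weaklyTendsto {u : ℕ → X} {x : X} {C : ℝ} (h : WeaklyTendsto 𝕜 u x)
    (hC : ∀ k, ‖u k‖ ≤ C) : ‖x‖ ≤ C := by
  obtain ⟨g, hg1, hg⟩ := exists_dual_vector'' 𝕜 x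
  have h1 : ‖g x‖ ≤ C := by
    refine le_of_tendsto (h g).norm (Eventually.of_forall fun k => ?_)
    calc ‖g (u k)‖ ≤ 1 * ‖u k‖ := g.le_of_opNorm_le hg1 _
      _ ≤ C := by rw [one_mul]; exact hC k
  rwa [hg, RCLike.norm_ofReal, abs_norm] at h1

theorem dense_of_forall_dual_eq_zero (p : Submodule 𝕜 X)
    (h : ∀ μ : StrongDual 𝕜 X, (∀ x ∈ p, μ x = 0) → μ = 0) : Dense (p : Set X) := by
  intro x
  rw [← Submodule.topologicalClosure_coe]
  by_contra hx
  set q := p.topologicalClosure with hq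
  have hcl : IsClosed (q : Set X) := p.isClosed_topologicalClosure
  have hne : ‖q.mkQL x‖ ≠ 0 := by
    rw [norm_ne_zero_iff]
    intro h0
    exact hx ((Submodule.Quotient.mk_eq_zero q).1 h0)
  obtain ⟨g, -, hg⟩ := exists_dual_vector 𝕜 (q.mkQL x) hne
  have h0 := h (g.comp q.mkQL) fun y hy => by
    have : q.mkQL y = 0 := (Submodule.Quotient.mk_eq_zero q).2 (p.le_topologicalClosure hy)
    simp [this]
  have h1 := congrArg (fun A : StrongDual 𝕜 X => A x) h0
  simp only [ContinuousLinearMap.comp_apply, hg] at h1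
  exact hne (by simpa using h1)

/-- Diagonal extraction for countably many weakly sequentially relatively compact sequences. -/
theorem exists_subseq_forall_weaklyTendsto {u : ℕ → ℕ → X}
    (hu : ∀ j, WeaklySeqRelCompact 𝕜 (u j)) {p : ℕ → ℕ} (hp : StrictMono p) :
    ∃ q : ℕ → ℕ, StrictMono q ∧ ∀ j, ∃ x, WeaklyTendsto 𝕜 (fun k => u j (p (q k))) x := by
  have hstep : ∀ (j : ℕ) (Q : {Q : ℕ → ℕ // StrictMono Q}), ∃ q : ℕ → ℕ, StrictMono q ∧
      ∃ x, WeaklyTendsto 𝕜 (fun k => u j (p (Q.1 (q k)))) x := by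
    intro j Q
    obtain ⟨q, hq, x, hx⟩ := hu j (p ∘ Q.1) (hp.comp Q.2)
    exact ⟨q, hq, x, weaklyTendsto_of_tendsto_toWeakSpace hx⟩
  choose r hr x hx using hstep
  let Q : ℕ → {Q : ℕ → ℕ // StrictMono Q} :=
    fun n => Nat.rec ⟨id, strictMono_id⟩ (fun j Q => ⟨Q.1 ∘ r j Q, Q.2.comp (hr j Q)⟩) n
  have hQ : ∀ j, (Q (j + 1)).1 = (Q j).1 ∘ r j (Q j) := fun j => rfl
  have hQle : ∀ j m, ∃ s : ℕ → ℕ, StrictMono s ∧ (Q (j + m)).1 = (Q j).1 ∘ s := by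
    intro j m
    induction m with
    | zero => exact ⟨id, strictMono_id, rfl⟩
    | succ m ih =>
      obtain ⟨s, hs, hs'⟩ := ih
      exact ⟨s ∘ r (j + m) (Q (j + m)), hs.comp (hr _ _), by
        rw [← add_assoc, hQ, hs', Function.comp_assoc]⟩
  refine ⟨fun n => (Q n).1 n, strictMono_nat_of_lt_succ fun n => ?_, fun j => ⟨x j (Q j), ?_⟩⟩
  · rw [hQ]
    exact (Q n).2 (n.lt_succ_self.trans_le ((hr n (Q n)).le_apply))
  · intro φ
    have h1 := hx j (Q j) φ
    rw [tendsto_atTop'] at h1 ⊢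
    intro s hs
    obtain ⟨N, hN⟩ := h1 s hs
    refine ⟨max N (j + 1), fun n hn => ?_⟩
    obtain ⟨m, rfl⟩ := Nat.exists_eq_add_of_le (le_of_max_le_right hn)
    obtain ⟨σ, hσ, hσ'⟩ := hQle (j + 1) m
    have := hN (σ (j + 1 + m)) ((le_of_max_le_left hn).trans hσ.le_apply)
    change φ (u j (p ((Q (j + 1 + m)).1 (j + 1 + m)))) ∈ s
    rw [hσ']
    exact this

/-- Weak limits of `B k g` for `g` in a sequence converging to `z` give a weak limit of `B k z`. -/
theorem exists_weaklyTendsto_of_approx [CompleteSpace X] {B : ℕ → X →L[𝕜] X} {C : ℝ}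
    (hB : ∀ k, ‖B k‖ ≤ C) {g : ℕ → X} {z : X} (hg : Tendsto g atTop (𝓝 z))
    (h : ∀ j, ∃ x, WeaklyTendsto 𝕜 (fun k => B k (g j)) x) :
    ∃ x, WeaklyTendsto 𝕜 (fun k => B k z) x := by
  choose γ hγ using h
  have hC : 0 ≤ C := (norm_nonneg _).trans (hB 0)
  have hγd : ∀ i j, ‖γ i - γ j‖ ≤ C * ‖g i - g j‖ := by
    intro i j
    refine norm_le_of_weaklyTendsto (𝕜 := 𝕜) (u := fun k => B k (g i - g j)) (fun φ => ?_)
      fun k => norm_apply_le_of_le (hB k) _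
    simpa only [map_sub] using (hγ i φ).sub (hγ j φ)
  have hcau : CauchySeq γ := by
    rw [Metric.cauchySeq_iff]
    intro ε hε
    obtain ⟨N, hN⟩ := Metric.cauchySeq_iff.1 hg.cauchySeq (ε / (C + 1)) (by positivity)
    refine ⟨N, fun m hm n hn => ?_⟩
    have := hN m hm n hn
    rw [dist_eq_norm] at this ⊢
    calc _ ≤ C * ‖g m - g n‖ := hγd m n
      _ ≤ (C + 1) * ‖g m - g n‖ := by gcongr; linarith
      _ < (C + 1) * (ε / (C + 1)) := by gcongr
      _ = ε := by field_simp
  obtain ⟨x, hx⟩ := cauchySeq_tendsto_of_complete hcau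
  refine ⟨x, fun φ => ?_⟩
  have hunif : TendstoUniformlyOnFilter (fun (j k : ℕ) => φ (B k (g j))) (fun k => φ (B k z))
      atTop atTop := by
    rw [Metric.tendstoUniformlyOnFilter_iff]
    intro ε hε
    set K := ‖φ‖ * C + 1 with hK
    have hKpos : 0 < K := by positivity
    have h1 := (Metric.tendsto_nhds.1 hg (ε / K) (by positivity)).prod_inl (atTop : Filter ℕ)
    filter_upwards [h1] with n hn
    rw [dist_comm, dist_eq_norm] at hn
    rw [dist_eq_norm, ← map_sub, ← map_sub]
    calc _ ≤ ‖φ‖ * (C * ‖z - g n.1‖) := (φ.le_opNorm _).trans (by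
          gcongr
          exact norm_apply_le_of_le (hB _) _)
      _ ≤ K * ‖z - g n.1‖ := by rw [← mul_assoc]; gcongr; rw [hK]; linarith
      _ < K * (ε / K) := by gcongr
      _ = ε := by field_simp
  exact hunif.tendsto_of_eventually_tendsto (Eventually.of_forall fun j => hγ j φ)
    ((φ.continuous.tendsto _).comp hx)

end Duality

section Averages

/-- A piecewise constant function on a uniform grid integrates to its Riemann sum. -/
theorem integral_comp_floor (b : ℕ → ℝ) {n : ℕ} (hn : 0 < n) (N : ℕ) :
    ∫ r in (0 : ℝ)..((N : ℝ) / n), b ⌊(n : ℝ) * r⌋₊ = (∑ k ∈ Finset.range N, b k) / n := by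
  have hn' : (0 : ℝ) < n := by exact_mod_cast hn
  have hlt : ∀ k : ℕ, (k : ℝ) / n ≤ ((k + 1 : ℕ) : ℝ) / n := fun k => by
    gcongr; exact k.le_succ
  have hEq : ∀ k : ℕ, Set.EqOn (fun r : ℝ => b ⌊(n : ℝ) * r⌋₊) (fun _ => b k)
      (Set.Ioo ((k : ℝ) / n) (((k + 1 : ℕ) : ℝ) / n)) := by
    intro k r hr
    have h1 := (div_lt_iff₀ hn').1 hr.1
    have h2 := (lt_div_iff₀ hn').1 hr.2
    have : ⌊(n : ℝ) * r⌋₊ = k := by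
      rw [Nat.floor_eq_iff (by nlinarith [Nat.cast_nonneg (α := ℝ) k])]
      push_cast at h2
      exact ⟨by linarith, by linarith⟩
    simp only [this]
  have hae : ∀ k : ℕ, ∀ᵐ r : ℝ, r ∈ Set.uIoc ((k : ℝ) / n) (((k + 1 : ℕ) : ℝ) / n) →
      b ⌊(n : ℝ) * r⌋₊ = b k := by
    intro k
    have : ∀ᵐ r : ℝ, r ≠ ((k + 1 : ℕ) : ℝ) / n := by
      simp [MeasureTheory.ae_iff, MeasureTheory.measure_singleton]
    filter_upwards [this] with r hr hr'
    rw [Set.uIoc_of_le (hlt k)] at hr'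
    exact hEq k ⟨hr'.1, lt_of_le_of_ne hr'.2 hr⟩
  have hint : ∀ k < N, IntervalIntegrable (fun r : ℝ => b ⌊(n : ℝ) * r⌋₊) MeasureTheory.volume
      ((k : ℝ) / n) (((k + 1 : ℕ) : ℝ) / n) := by
    intro k _
    refine (intervalIntegrable_const (c := b k)).congr_ae ?_
    rw [Filter.EventuallyEq, MeasureTheory.ae_restrict_iff' measurableSet_uIoc]
    filter_upwards [hae k] with r hr hr'
    exact (hr hr').symm
  have := intervalIntegral.sum_integral_adjacent_intervals hint
  rw [Nat.cast_zero, zero_div] at this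
  rw [← this, Finset.sum_div]
  refine Finset.sum_congr rfl fun k _ => ?_
  rw [intervalIntegral.integral_congr_ae (hae k), intervalIntegral.integral_const, smul_eq_mul]
  push_cast
  field_simp
  ring

/-- Bounded convergence for Riemann sums on uniform grids. -/
theorem tendsto_average_of_tendsto_floor {b : ℕ → ℕ → ℝ} {C : ℝ} {S : ℕ}
    (hC : ∀ᶠ n in atTop, ∀ k ≤ n * S, |b n k| ≤ C)
    (h : ∀ s : ℝ≥0, Tendsto (fun n : ℕ => b n ⌊n * s⌋₊) atTop (𝓝 0)) :
    Tendsto (fun n : ℕ => (∑ k ∈ Finset.range (n * S), b n k) / n) atTop (𝓝 0) := by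
  have hlim : Tendsto (fun n : ℕ => ∫ r in (0 : ℝ)..S, b n ⌊(n : ℝ) * r⌋₊) atTop
      (𝓝 (∫ r in (0 : ℝ)..S, (0 : ℝ))) := by
    refine intervalIntegral.tendsto_integral_filter_of_dominated_convergence (fun _ => C) ?_ ?_
      intervalIntegrable_const ?_
    · refine Eventually.of_forall fun n => ?_
      have h1 : Measurable fun r : ℝ => ⌊(n : ℝ) * r⌋₊ :=
        Nat.measurable_floor.comp (measurable_const_mul _)
      exact ((measurable_from_top (f := b n)).comp h1).aestronglyMeasurable
    · filter_upwards [hC] with n hn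
      refine Eventually.of_forall fun r hr => ?_
      rw [Set.uIoc_of_le (Nat.cast_nonneg S)] at hr
      refine hn _ (Nat.floor_le_of_le ?_)
      push_cast
      exact mul_le_mul_of_nonneg_left hr.2 (Nat.cast_nonneg n)
    · refine Eventually.of_forall fun r hr => ?_
      rw [Set.uIoc_of_le (Nat.cast_nonneg S)] at hr
      have := h ⟨r, hr.1.le⟩
      refine this.congr fun n => ?_
      congr 1
  rw [intervalIntegral.integral_zero] at hlim
  refine hlim.congr' ?_
  filter_upwards [eventually_gt_atTop 0] with n hn
  have hn' : (n : ℝ) ≠ 0 := by positivity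
  rw [← integral_comp_floor _ hn]
  congr 1
  push_cast
  field_simp

end Averages

section Range

variable {𝕜 X : Type*} [RCLike 𝕜] [NormedAddCommGroup X] [NormedSpace 𝕜 X]
  {F : ℝ≥0 → X →L[𝕜] X} {M a : ℝ} {t : ℝ≥0} {Z : X →ₗ.[𝕜] X}

theorem norm_pow_floor_le (hM : 1 ≤ M) (ha : 0 < a)
    (hF : ∀ (h : ℝ≥0) (k : ℕ), ‖F h ^ k‖ ≤ M * Real.exp (a * k * h)) {n k : ℕ} {s : ℝ≥0}
    (hk : (k : ℝ≥0) ≤ n * s) : ‖F (t / n) ^ k‖ ≤ M * Real.exp (a * (s * t)) := by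
  refine (hF _ _).trans ?_
  have h1 : (k : ℝ≥0) * (t / n) ≤ s * t := by
    calc (k : ℝ≥0) * (t / n) ≤ (n * s) * (t / n) := by gcongr
      _ = s * t * (n / n) := by ring
      _ ≤ s * t * 1 := by gcongr; exact div_self_le_one _
      _ = s * t := mul_one _
  have h2 : (k : ℝ) * ((t / n : ℝ≥0) : ℝ) ≤ s * t := by exact_mod_cast h1
  rw [mul_assoc]
  gcongr

/-- A functional in the domain of `(F^*)'(0)` turns `Z` into a bounded functional. -/
theorem dual_apply_eq (h0 : F 0 = ContinuousLinearMap.id 𝕜 X) {φ ψ : StrongDual 𝕜 X}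
    (hφ : HasStrongDerivAtZero (dualFun F) φ ψ) :
    Tendsto (fun h => φ.comp (differenceQuotient F h)) (𝓝[≠] 0) (𝓝 ψ) := by
  refine hφ.congr fun h => ?_
  ext x
  simp [dualFun, differenceQuotient, h0]

/-- Along the discrete trajectories started in the approximation space, a functional
annihilating the range of `c - Z` asymptotically annihilates the discrete operator. -/
theorem tendsto_dual_apply_trajectory [CompleteSpace X]
    (h0 : F 0 = ContinuousLinearMap.id 𝕜 X) (hM : 1 ≤ M)
    (ha : 0 < a) (hF : ∀ (h : ℝ≥0) (k : ℕ), ‖F h ^ k‖ ≤ M * Real.exp (a * k * h)) (ht : 0 < t)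
    (hZF : ∀ x : Z.domain, HasStrongDerivAtZero F (x : X) (Z x))
    (hdual : WeakStarDense ((strongDeriv (dualFun F)).domain : Set (StrongDual 𝕜 X)))
    {A : Submodule 𝕜 X} (hA : Dense (A : Set X)) (s : ℝ≥0)
    (happ : ∀ f ∈ A, ∃ u : ℕ → Z.domain,
      Tendsto (fun n : ℕ => ‖(F (t / n) ^ ⌊n * s⌋₊) f - (u n : X)‖) atTop (𝓝 0) ∧
      WeaklySeqRelCompact 𝕜 (fun n => (u n : X)) ∧
      WeaklySeqRelCompact 𝕜 (fun n => Z (u n)))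
    {c : ℝ} {μ : StrongDual 𝕜 X} (hμ : ∀ x : Z.domain, μ ((c : 𝕜) • (x : X) - Z x) = 0)
    {f z : X} (hfA : f ∈ A) (hfz : HasStrongDerivAtZero F f z) :
    Tendsto (fun n : ℕ => μ ((F (t / n) ^ ⌊n * s⌋₊)
      (differenceQuotient F (t / n) f - (c : 𝕜) • f))) atTop (𝓝 0) := by
  have hne := neBot_nhdsNE_zero
  set B : ℕ → X →L[𝕜] X := fun n => F (t / n) ^ ⌊n * s⌋₊ with hBdef
  set D : ℕ → X →L[𝕜] X := fun n => differenceQuotient F (t / n) with hDdef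
  set C := M * Real.exp (a * (s * t)) with hC
  have hB : ∀ n, ‖B n‖ ≤ C := fun n => norm_pow_floor_le hM ha hF (Nat.floor_le zero_le)
  have hDf : Tendsto (fun n => D n f) atTop (𝓝 z) :=
    (tendsto_differenceQuotient h0 hfz).comp (tendsto_div_nat_nhdsNE ht)
  have hcomm : ∀ n x, B n (D n x) = D n (B n x) := by
    intro n x
    have : Commute (B n) (D n) :=
      (((Commute.refl (F (t / n))).sub_right (Commute.one_right _)).smul_right _).pow_left _
    exact congrArg (fun T : X →L[𝕜] X => T x) this.eq
  obtain ⟨g, hgA, hg⟩ := mem_closure_iff_seq_limit.1 (hA z)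
  choose u hu1 hu2 hu3 using happ
  refine tendsto_of_subseq_tendsto fun ns hns => ?_
  obtain ⟨σ, hσ, hp⟩ := strictMono_subseq_of_tendsto_atTop hns
  set W : ℕ → ℕ → X := fun j => match j with
    | 0 => fun n => (u f hfA n : X)
    | 1 => fun n => Z (u f hfA n)
    | j + 2 => fun n => (u (g j) (hgA j) n : X) with hW
  have hWc : ∀ j, WeaklySeqRelCompact 𝕜 (W j) := by
    intro j
    match j with
    | 0 => exact hu2 f hfA
    | 1 => exact hu3 f hfA
    | j + 2 => exact hu2 (g j) (hgA j)
  obtain ⟨q, hq, hlim⟩ := exists_subseq_forall_weaklyTendsto hWc hp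
  set p : ℕ → ℕ := fun k => ns (σ (q k)) with hpdef
  have hpt : Tendsto p atTop atTop := hp.tendsto_atTop.comp hq.tendsto_atTop
  obtain ⟨x, hx⟩ := hlim 0
  obtain ⟨v, hv⟩ := hlim 1
  have hx' : WeaklyTendsto 𝕜 (fun k => (u f hfA (p k) : X)) x := hx
  have hv' : WeaklyTendsto 𝕜 (fun k => Z (u f hfA (p k))) v := hv
  have hdiff : ∀ (y : X) (hy : y ∈ A) (φ : StrongDual 𝕜 X),
      Tendsto (fun k => φ (B (p k) y - (u y hy (p k) : X))) atTop (𝓝 0) := by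
    intro y hy φ
    have h1 : Tendsto (fun n => B n y - (u y hy n : X)) atTop (𝓝 0) :=
      tendsto_zero_iff_norm_tendsto_zero.2 (hu1 y hy)
    have h2 := (φ.continuous.tendsto _).comp (h1.comp hpt)
    rw [map_zero] at h2
    exact h2
  have hBx : WeaklyTendsto 𝕜 (fun k => B (p k) f) x := by
    intro φ
    refine (by simpa only [zero_add] using (hdiff f hfA φ).add (hx' φ) :
      Tendsto _ _ (𝓝 (φ x))).congr fun k => ?_
    rw [← map_add, sub_add_cancel]
  obtain ⟨γ, hγ⟩ : ∃ γ, WeaklyTendsto 𝕜 (fun k => B (p k) z) γ := by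
    refine exists_weaklyTendsto_of_approx (fun k => hB (p k)) hg fun j => ?_
    obtain ⟨y, hy⟩ := hlim (j + 2)
    refine ⟨y, fun φ => ?_⟩
    have hy' : WeaklyTendsto 𝕜 (fun k => (u (g j) (hgA j) (p k) : X)) y := hy
    refine (by simpa only [zero_add] using (hdiff (g j) (hgA j) φ).add (hy' φ) :
      Tendsto _ _ (𝓝 (φ y))).congr fun k => ?_
    rw [← map_add, sub_add_cancel]
  have hBD : WeaklyTendsto 𝕜 (fun k => B (p k) (D (p k) f)) γ := by
    intro φ
    have h1 : Tendsto (fun k => B (p k) (D (p k) f - z)) atTop (𝓝 0) := by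
      refine tendsto_apply_apply (T := fun k => B (p k)) (Eventually.of_forall fun k => hB (p k))
        (x := 0) ?_ (by simp)
      simpa using (hDf.comp hpt).sub_const z
    have h2 := (φ.continuous.tendsto _).comp h1
    rw [map_zero] at h2
    refine (by simpa using h2.add (hγ φ) : Tendsto _ _ (𝓝 (φ γ))).congr fun k => ?_
    simp
  have hvγ : γ - v = 0 := by
    refine hdual.eq_zero ?_
    rintro φ ⟨ψ, hψ⟩
    have hconv := dual_apply_eq h0 hψ
    have hZψ : ∀ y : Z.domain, φ (Z y) = ψ y := by
      intro y
      have h1 := (φ.continuous.tendsto _).comp (tendsto_differenceQuotient h0 (hZF y))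
      have h2 := ((ContinuousLinearMap.apply 𝕜 𝕜 (y : X)).continuous.tendsto _).comp hconv
      exact tendsto_nhds_unique h1 h2
    have hφv : φ v = ψ x := by
      refine tendsto_nhds_unique (hv' φ) ?_
      simpa only [hZψ] using hx' ψ
    have hφγ : φ γ = ψ x := by
      refine tendsto_nhds_unique (hBD φ) ?_
      have h1 : Tendsto (fun n => φ.comp (D n) - ψ) atTop (𝓝 0) := by
        simpa using ((hconv.comp (tendsto_div_nat_nhdsNE ht)).sub_const ψ)
      have h2 : Tendsto (fun k => (φ.comp (D (p k)) - ψ) (B (p k) f)) atTop (𝓝 0) := by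
        refine squeeze_zero_norm (a := fun k => ‖φ.comp (D (p k)) - ψ‖ * (C * ‖f‖)) (fun k => ?_) ?_
        · refine (ContinuousLinearMap.le_opNorm _ _).trans ?_
          gcongr
          exact norm_apply_le_of_le (hB _) _
        · simpa using ((h1.comp hpt).norm).mul_const (C * ‖f‖)
      refine (by simpa using h2.add (hBx ψ) : Tendsto _ _ (𝓝 (ψ x))).congr fun k => ?_
      simp [hcomm]
    rw [map_sub, hφv, hφγ, sub_self]
  have hμv : μ v = (c : 𝕜) * μ x := by
    refine tendsto_nhds_unique (hv' μ) ?_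
    refine ((hx' μ).const_mul (c : 𝕜)).congr fun k => ?_
    have := hμ (u f hfA (p k))
    rw [map_sub, map_smul, sub_eq_zero] at this
    rw [← this, smul_eq_mul]
  refine ⟨fun k => σ (q k), ?_⟩
  have := (hBD μ).sub ((hBx μ).const_mul (c : 𝕜))
  rw [sub_eq_zero.1 hvγ, hμv, sub_self] at this
  refine this.congr fun k => ?_
  rw [map_sub, map_sub, map_smul, map_smul, smul_eq_mul]

theorem norm_dual_apply_le (ht : 0 < t) {c : ℝ} (hc : 0 < c) (μ : StrongDual 𝕜 X) (f : X) {n : ℕ}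
    (hn : 0 < n) (N : ℕ) :
    ‖μ f‖ ≤ ((1 + c * t / n)⁻¹) ^ N * ‖μ ((F (t / n) ^ N) f)‖ +
      t * ((∑ k ∈ Finset.range N,
        ‖μ ((F (t / n) ^ k) (differenceQuotient F (t / n) f - (c : 𝕜) • f))‖) / n) := by
  have hn' : (0 : ℝ) < n := by exact_mod_cast hn
  have ht' : (0 : ℝ) < t := by exact_mod_cast ht
  have hhne : t / (n : ℝ≥0) ≠ 0 := (div_pos ht (by exact_mod_cast hn)).ne'
  set h : ℝ≥0 := t / n with hh
  have hhr : (h : ℝ) = t / n := by rw [hh]; push_cast; rfl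
  set d : ℝ := 1 + c * h with hd
  have hdpos : 1 ≤ d := by
    have : 0 ≤ c * (h : ℝ) := by positivity
    rw [hd]
    linarith
  have hd' : (d : 𝕜) ≠ 0 := by
    have : d ≠ 0 := by linarith
    exact_mod_cast this
  set q : 𝕜 := (d : 𝕜)⁻¹ with hq
  have hqn : ‖q‖ = d⁻¹ := by
    rw [hq, norm_inv, RCLike.norm_ofReal, abs_of_pos (by linarith)]
  set w := differenceQuotient F h f - (c : 𝕜) • f with hw
  have hterm : ∀ k, (q ^ (k + 1) * ((h : ℝ) : 𝕜)) • (F h ^ k) w =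
      q ^ (k + 1) • (F h ^ (k + 1)) f - q ^ k • (F h ^ k) f := by
    intro k
    have e1 : ((h : ℝ) : 𝕜) • w = F h f - (d : 𝕜) • f := by
      rw [apply_eq_add_differenceQuotient hhne, hw, hd]
      push_cast
      module
    have e2 : q ^ k = q ^ (k + 1) * d := by
      rw [pow_succ, mul_assoc, hq, inv_mul_cancel₀ hd', mul_one]
    rw [mul_smul, ← map_smul, e1, map_sub, map_smul, smul_sub, e2, mul_smul, pow_succ (F h) k]
    rfl
  have hsum : ∑ k ∈ Finset.range N, (q ^ (k + 1) * ((h : ℝ) : 𝕜)) • (F h ^ k) w =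
      q ^ N • (F h ^ N) f - f := by
    rw [Finset.sum_congr rfl fun k _ => hterm k, Finset.sum_range_sub fun k => q ^ k • (F h ^ k) f]
    simp
  have hμ : μ f = q ^ N * μ ((F h ^ N) f) -
      ∑ k ∈ Finset.range N, (q ^ (k + 1) * ((h : ℝ) : 𝕜)) * μ ((F h ^ k) w) := by
    have := congrArg μ hsum
    rw [map_sum, map_sub, map_smul, smul_eq_mul] at this
    simp only [map_smul, smul_eq_mul] at this
    rw [this]; ring
  rw [hμ]
  refine (norm_sub_le _ _).trans (add_le_add ?_ ?_)
  · rw [norm_mul, norm_pow, hqn, hd, hhr, mul_div_assoc]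
  · rw [Finset.sum_div, Finset.mul_sum]
    refine norm_sum_le_of_le _ fun k _ => ?_
    rw [norm_mul, norm_mul, norm_pow, hqn, RCLike.norm_ofReal, NNReal.abs_eq, hhr]
    have : d⁻¹ ^ (k + 1) ≤ 1 :=
      pow_le_one₀ (inv_nonneg.2 (by linarith)) (inv_le_one_of_one_le₀ hdpos)
    calc _ ≤ 1 * (t / n : ℝ) * ‖μ ((F h ^ k) w)‖ := by gcongr
      _ = _ := by ring

/-- Under the Chernoff conditions, `c - Z` has dense range for large `c`. -/
theorem dense_range_of_chernoffConditions [CompleteSpace X]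
    (h0 : F 0 = ContinuousLinearMap.id 𝕜 X) (hM : 1 ≤ M)
    (ha : 0 < a) (hF : ∀ (h : ℝ≥0) (k : ℕ), ‖F h ^ k‖ ≤ M * Real.exp (a * k * h)) (ht : 0 < t)
    (hcond : ChernoffConditions t Z F) {c : ℝ} (hc : a < c) :
    Dense (Set.range fun x : Z.domain => (c : 𝕜) • (x : X) - Z x) := by
  have hZF : ∀ x : Z.domain, HasStrongDerivAtZero F (x : X) (Z x) := by
    intro x
    have h1 := strongDeriv_apply F ⟨x, hcond.extends_op.1 x.2⟩
    rwa [← hcond.extends_op.2 (x := x) (y := ⟨x, hcond.extends_op.1 x.2⟩) rfl] at h1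
  obtain ⟨A, hAZ, hA, happ⟩ := hcond.approx
  refine dense_of_forall_dual_eq_zero (LinearMap.range ((c : 𝕜) • Z.domain.subtype - Z.toFun))
    fun μ hμ => ?_
  have hμ' : ∀ x : Z.domain, μ ((c : 𝕜) • (x : X) - Z x) = 0 := fun x => hμ _ ⟨x, rfl⟩
  have hc0 : 0 < c := ha.trans hc
  have ht' : (0 : ℝ) < t := by exact_mod_cast ht
  have hμA : ∀ f ∈ A, μ f = 0 := by
    intro f hf
    have hfz := hZF ⟨f, hAZ hf⟩
    set z := Z ⟨f, hAZ hf⟩ with hz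
    have hbound : ∀ S : ℕ, ‖μ f‖ ≤ ‖μ‖ * M * ‖f‖ * Real.exp ((a - c) * t) ^ S := by
      intro S
      set C := M * Real.exp (a * (S * t)) with hC
      have hpow : ∀ n k : ℕ, k ≤ n * S → ‖F (t / n) ^ k‖ ≤ C := by
        intro n k hk
        have := norm_pow_floor_le (t := t) (s := (S : ℝ≥0)) (n := n) hM ha hF
          (k := k) (by exact_mod_cast hk)
        simpa using this
      have hav := tendsto_average_of_tendsto_floor (S := S) (C := ‖μ‖ * (C * (‖z - (c : 𝕜) • f‖ + 1)))
        (b := fun n k => ‖μ ((F (t / n) ^ k)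
          (differenceQuotient F (t / n) f - (c : 𝕜) • f))‖) ?_ ?_
      · have hq : Tendsto (fun n : ℕ => ((1 + c * t / n)⁻¹) ^ (n * S)) atTop
            (𝓝 (((Real.exp (c * t))⁻¹) ^ S)) := by
          have := ((Real.tendsto_one_add_div_pow_exp (c * t)).inv₀ (Real.exp_pos _).ne').pow S
          refine this.congr fun n => ?_
          rw [pow_mul, inv_pow (1 + c * t / n) n]
        have hlim := (hq.mul_const (‖μ‖ * (C * ‖f‖))).add (hav.const_mul (t : ℝ))
        have hle : ‖μ f‖ ≤ ((Real.exp (c * t))⁻¹) ^ S * (‖μ‖ * (C * ‖f‖)) + t * 0 := by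
          refine ge_of_tendsto hlim ?_
          filter_upwards [eventually_gt_atTop 0] with n hn
          refine (norm_dual_apply_le (F := F) ht hc0 μ f hn (n * S)).trans ?_
          gcongr
          refine (μ.le_opNorm _).trans ?_
          gcongr
          exact norm_apply_le_of_le (hpow n _ le_rfl) _
        refine hle.trans_eq ?_
        rw [mul_zero, add_zero, hC, ← Real.exp_neg, ← Real.exp_nat_mul, ← Real.exp_nat_mul,
          show (S : ℝ) * ((a - c) * t) = S * -(c * t) + a * (S * t) by ring, Real.exp_add]
        ring
      · have h1 := ((tendsto_differenceQuotient h0 hfz).comp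
          (tendsto_div_nat_nhdsNE ht)).sub_const ((c : 𝕜) • f)
        filter_upwards [h1.norm.eventually_lt_const (lt_add_one _)] with n hn k hk
        rw [abs_norm]
        refine (μ.le_opNorm _).trans ?_
        gcongr
        refine (norm_apply_le_of_le (hpow n k hk) _).trans ?_
        gcongr
        exact hn.le
      · intro s
        have := (tendsto_dual_apply_trajectory h0 hM ha hF ht hZF hcond.dual_dense hA s
          (fun f hf => happ f hf s) hμ' hf hfz).norm
        simpa using this
    have hr : Real.exp ((a - c) * t) < 1 := Real.exp_lt_one_iff.2 (by nlinarith)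
    have hlim := (tendsto_pow_atTop_nhds_zero_of_lt_one (Real.exp_pos _).le hr).const_mul
      (‖μ‖ * M * ‖f‖)
    rw [mul_zero] at hlim
    exact norm_le_zero_iff.1 (ge_of_tendsto' hlim hbound)
  ext x
  have hcl : IsClosed {y : X | μ y = 0} := isClosed_eq μ.continuous continuous_const
  exact closure_minimal hμA hcl (hA x)

end Range

section IntegratedSemigroup

variable {𝕜 X : Type*} [RCLike 𝕜] [NormedAddCommGroup X] [NormedSpace 𝕜 X]

theorem IsC0Semigroup.exists_monotone_bound {T : ℝ≥0 → X →L[𝕜] X} (hT : IsC0Semigroup T) :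
    ∃ C b : ℝ, 0 ≤ C ∧ 0 ≤ b ∧ ∀ r s : ℝ≥0, s ≤ r → ‖T s‖ ≤ C * Real.exp (b * r) := by
  obtain ⟨M, a, hM, hb⟩ := hT.bound
  refine ⟨M, |a|, by linarith, abs_nonneg a, fun r s hs => (hb s).trans ?_⟩
  have hs' : (s : ℝ) ≤ r := by exact_mod_cast hs
  have : a * s ≤ |a| * r :=
    (mul_le_mul_of_nonneg_right (le_abs_self a) s.2).trans
      (mul_le_mul_of_nonneg_left hs' (abs_nonneg a))
  gcongr

theorem IsC0Semigroup.add_apply {T : ℝ≥0 → X →L[𝕜] X} (hT : IsC0Semigroup T) (r s : ℝ≥0)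
    (x : X) : T (r + s) x = T r (T s x) :=
  congrArg (fun A : X →L[𝕜] X => A x) (hT.map_add r s)

variable [CompleteSpace X]

/-- The integrated semigroup `V r x = ∫ T s x` over `[0, r]` and its basic estimates. -/
theorem IsC0Semigroup.exists_integrated {T : ℝ≥0 → X →L[𝕜] X} (hT : IsC0Semigroup T) :
    ∃ (V : ℝ≥0 → X →L[𝕜] X) (C b : ℝ), 0 ≤ C ∧
      (∀ r, ‖V r‖ ≤ C * Real.exp (b * r) * r) ∧
      (∀ u r x, T u (V r x) = V r (T u x)) ∧
      (∀ u r x, T u (V r x) - V r x = V u (T r x) - V u x) ∧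
      (∀ r h x, ‖V r (V h x) - ((h : ℝ) : 𝕜) • V r x‖ ≤
        C * Real.exp (b * h) * h * (‖T r‖ + 1) * ‖x‖ * h) ∧
      (∀ x (r : ℝ≥0) (ε : ℝ), (∀ s ≤ r, ‖T s x - x‖ ≤ ε) →
        ‖V r x - ((r : ℝ) : 𝕜) • x‖ ≤ ε * r) := by
  let : NormedSpace ℝ X := NormedSpace.restrictScalars ℝ 𝕜 X
  have : IsScalarTower ℝ 𝕜 X := IsScalarTower.of_algebraMap_smul fun r x => rfl
  have hsmul : ∀ (r : ℝ) (x : X), r • x = (r : 𝕜) • x := fun r x => rfl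
  obtain ⟨C, b, hC, hb, hCb⟩ := hT.exists_monotone_bound
  have hcont : ∀ x, Continuous fun s : ℝ => T s.toNNReal x := fun x =>
    (hT.continuous x).comp continuous_real_toNNReal
  have hint : ∀ x (p q : ℝ), IntervalIntegrable (fun s : ℝ => T s.toNNReal x)
      MeasureTheory.volume p q := fun x p q => (hcont x).intervalIntegrable p q
  have hmem : ∀ {r : ℝ≥0} {s : ℝ}, s ∈ Set.uIoc (0 : ℝ) r → 0 ≤ s ∧ s.toNNReal ≤ r := by
    intro r s hs
    rw [Set.uIoc_of_le r.coe_nonneg] at hs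
    exact ⟨hs.1.le, Real.toNNReal_le_iff_le_coe.2 hs.2⟩
  let L : ℝ≥0 → X →ₗ[𝕜] X := fun r =>
    { toFun := fun x => ∫ s in (0 : ℝ)..r, T s.toNNReal x
      map_add' := fun x y =>
        (intervalIntegral.integral_congr fun s _ => _root_.map_add (T s.toNNReal) x y).trans
          (intervalIntegral.integral_add (hint x _ _) (hint y _ _))
      map_smul' := fun c x =>
        (intervalIntegral.integral_congr fun s _ => map_smul (T s.toNNReal) c x).trans
          (intervalIntegral.integral_smul c _) }
  have hL : ∀ r x, ‖L r x‖ ≤ C * Real.exp (b * r) * r * ‖x‖ := by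
    intro r x
    have := intervalIntegral.norm_integral_le_of_norm_le_const (a := (0 : ℝ)) (b := r)
      (f := fun s : ℝ => T s.toNNReal x) (C := C * Real.exp (b * r) * ‖x‖) fun s hs =>
        norm_apply_le_of_le (hCb r _ (hmem hs).2) x
    rw [sub_zero, NNReal.abs_eq] at this
    exact this.trans_eq (by ring)
  let V : ℝ≥0 → X →L[𝕜] X := fun r => (L r).mkContinuous _ (hL r)
  have hV : ∀ r x, V r x = ∫ s in (0 : ℝ)..r, T s.toNNReal x := fun r x => rfl
  have hVn : ∀ r, ‖V r‖ ≤ C * Real.exp (b * r) * r := fun r =>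
    (L r).mkContinuous_norm_le (by positivity) (hL r)
  have hclm : ∀ (A : X →L[𝕜] X) (r : ℝ≥0) (x : X),
      A (V r x) = ∫ s in (0 : ℝ)..r, A (T s.toNNReal x) := fun A r x => by
    rw [hV]; exact (A.intervalIntegral_comp_comm (hint x _ _)).symm
  have hcomm : ∀ u r x, T u (V r x) = V r (T u x) := by
    intro u r x
    rw [hclm, hV]
    simp only [hT.apply_comm u]
  have hshift : ∀ u r x, T u (V r x) - V r x = V u (T r x) - V u x := by
    have h1 : ∀ (u r : ℝ≥0) x, V r (T u x) = ∫ s in (u : ℝ)..(u + r), T s.toNNReal x := by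
      intro u r x
      have e := intervalIntegral.integral_comp_add_left (a := (0 : ℝ)) (b := r)
        (fun s : ℝ => T s.toNNReal x) (u : ℝ)
      rw [add_zero] at e
      rw [← e, hV]
      refine intervalIntegral.integral_congr_ae (Eventually.of_forall fun s hs => ?_)
      rw [Real.toNNReal_add u.coe_nonneg (hmem hs).1, Real.toNNReal_coe, hT.add_apply, hT.apply_comm]
    intro u r x
    rw [hcomm, h1, h1, hV, hV, add_comm (r : ℝ) u]
    have e1 := intervalIntegral.integral_add_adjacent_intervals (hint x 0 u) (hint x u (u + r))
    have e2 := intervalIntegral.integral_add_adjacent_intervals (hint x 0 r) (hint x r (u + r))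
    rw [sub_eq_sub_iff_add_eq_add]
    exact (add_comm _ _).trans ((e1.trans e2.symm).trans (add_comm _ _))
  refine ⟨V, C, b, hC, hVn, hcomm, hshift, ?_, ?_⟩
  · intro r h x
    have e1 : ((h : ℝ) : 𝕜) • V r x = ∫ s in (0 : ℝ)..h, V r x := by
      rw [intervalIntegral.integral_const, sub_zero, hsmul]
    have hc : Continuous fun s : ℝ => V r (T s.toNNReal x) := (V r).continuous.comp (hcont x)
    rw [hclm, e1, ← intervalIntegral.integral_sub (hc.intervalIntegrable _ _)
      intervalIntegrable_const]
    have := intervalIntegral.norm_integral_le_of_norm_le_const (a := (0 : ℝ)) (b := h)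
      (f := fun s : ℝ => V r (T s.toNNReal x) - V r x)
      (C := C * Real.exp (b * h) * h * (‖T r‖ + 1) * ‖x‖) fun s hs => by
        have hs' := (hmem hs).2
        have hs'' : ((s.toNNReal : ℝ≥0) : ℝ) ≤ h := by exact_mod_cast hs'
        rw [← hcomm, hshift, ← map_sub]
        calc _ ≤ (C * Real.exp (b * s.toNNReal) * s.toNNReal) * ‖T r x - x‖ :=
              norm_apply_le_of_le (hVn _) _
          _ ≤ (C * Real.exp (b * h) * h) * (‖T r‖ * ‖x‖ + ‖x‖) := by
              gcongr
              exact (norm_sub_le _ _).trans (add_le_add_left ((T r).le_opNorm x) _)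
          _ = _ := by ring
    rwa [sub_zero, NNReal.abs_eq] at this
  · intro x r ε hε
    have e1 : ((r : ℝ) : 𝕜) • x = ∫ s in (0 : ℝ)..r, x := by
      rw [intervalIntegral.integral_const, sub_zero, hsmul]
    rw [hV, e1, ← intervalIntegral.integral_sub (hint x _ _) intervalIntegrable_const]
    have := intervalIntegral.norm_integral_le_of_norm_le_const (a := (0 : ℝ)) (b := r)
      (f := fun s : ℝ => T s.toNNReal x - x) (C := ε) fun s hs => hε _ (hmem hs).2
    rwa [sub_zero, NNReal.abs_eq] at this

/-- The adjoint of a `C₀`-semigroup is norm differentiable on a weak-* dense set. -/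
theorem IsC0Semigroup.weakStarDense_strongDeriv_dualFun {T : ℝ≥0 → X →L[𝕜] X}
    (hT : IsC0Semigroup T) :
    WeakStarDense ((strongDeriv (dualFun T)).domain : Set (StrongDual 𝕜 X)) := by
  have hne := neBot_nhdsNE_zero
  obtain ⟨V, C, b, hC, hVn, hcomm, hshift, hVV, hVx⟩ := hT.exists_integrated
  have hKlim : Tendsto (fun h : ℝ≥0 => C * Real.exp (b * h) * h) (𝓝[≠] 0) (𝓝 0) := by
    have h1 : Continuous fun h : ℝ≥0 => C * Real.exp (b * h) * (h : ℝ) := by fun_prop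
    simpa using (h1.tendsto 0).mono_left nhdsWithin_le_nhds
  have hdom : ∀ (φ : StrongDual 𝕜 X) (r : ℝ≥0), HasStrongDerivAtZero (dualFun T)
      (φ.comp ((V r).comp (V r))) (φ.comp ((V r).comp (T r - ContinuousLinearMap.id 𝕜 X))) := by
    intro φ r
    rw [HasStrongDerivAtZero, tendsto_iff_norm_sub_tendsto_zero]
    set K := ‖φ‖ * ((‖T r‖ + 1) * ‖T r - ContinuousLinearMap.id 𝕜 X‖) with hK
    refine squeeze_zero_norm' (a := fun h : ℝ≥0 => C * Real.exp (b * h) * h * K) ?_ ?_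
    · filter_upwards [self_mem_nhdsWithin] with h hh
      have hh' : 0 < (h : ℝ) := by exact_mod_cast pos_iff_ne_zero.2 hh
      have hhk : ((h : ℝ) : 𝕜) ≠ 0 := by exact_mod_cast hh'.ne'
      rw [norm_norm]
      refine ContinuousLinearMap.opNorm_le_bound _ (by positivity) fun x => ?_
      set y := (T r - ContinuousLinearMap.id 𝕜 X) x with hy
      have e : ((((h : ℝ) : 𝕜)⁻¹) • (dualFun T h (φ.comp ((V r).comp (V r))) -
          dualFun T 0 (φ.comp ((V r).comp (V r)))) -
          φ.comp ((V r).comp (T r - ContinuousLinearMap.id 𝕜 X))) x =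
          φ ((((h : ℝ) : 𝕜)⁻¹) • (V r (V h y) - ((h : ℝ) : 𝕜) • V r y)) := by
        have e1 : V r (T h x) - V r x = V h y := by
          rw [← hcomm, hshift, hy]; simp
        rw [smul_sub _ (V r (V h y)), smul_smul, inv_mul_cancel₀ hhk, one_smul, ← e1]
        simp [dualFun, hT.map_zero, hy]
      rw [e]
      have h1 : ‖(((h : ℝ) : 𝕜)⁻¹) • (V r (V h y) - ((h : ℝ) : 𝕜) • V r y)‖ ≤
          C * Real.exp (b * h) * h * (‖T r‖ + 1) * ‖y‖ := by
        rw [norm_smul, norm_inv, RCLike.norm_ofReal, NNReal.abs_eq, inv_mul_le_iff₀ hh']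
        exact (hVV r h y).trans_eq (by ring)
      calc _ ≤ ‖φ‖ * (C * Real.exp (b * h) * h * (‖T r‖ + 1) *
            (‖T r - ContinuousLinearMap.id 𝕜 X‖ * ‖x‖)) := by
            refine (φ.le_opNorm _).trans ?_
            gcongr
            refine h1.trans ?_
            gcongr
            exact ContinuousLinearMap.le_opNorm _ _
        _ = _ := by rw [hK]; ring
    · simpa using hKlim.mul_const K
  intro φ'
  set φ : StrongDual 𝕜 X := WeakDual.toStrongDual φ' with hφ
  set W : ℝ≥0 → X →L[𝕜] X := fun r => (((r : ℝ) : 𝕜)⁻¹) • V r with hW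
  have hWx : ∀ x, Tendsto (fun r => W r x) (𝓝[≠] 0) (𝓝 x) := by
    intro x
    rw [Metric.tendsto_nhds]
    intro ε hε
    have h1 : ∀ᶠ s : ℝ≥0 in 𝓝 0, ‖T s x - x‖ < ε / 2 := by
      have := (hT.continuous x).tendsto 0
      rw [hT.map_zero, ContinuousLinearMap.id_apply] at this
      simpa [dist_eq_norm] using Metric.tendsto_nhds.1 this (ε / 2) (by positivity)
    obtain ⟨δ, hδ, hδ'⟩ := Metric.eventually_nhds_iff.1 h1
    have h2 : ∀ᶠ r : ℝ≥0 in 𝓝[≠] 0, dist r 0 < δ :=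
      nhdsWithin_le_nhds (Metric.ball_mem_nhds 0 hδ)
    filter_upwards [h2, self_mem_nhdsWithin] with r hr hr0
    have hr' : 0 < (r : ℝ) := by exact_mod_cast pos_iff_ne_zero.2 hr0
    have hrk : ((r : ℝ) : 𝕜) ≠ 0 := by exact_mod_cast hr'.ne'
    have h3 := hVx x r (ε / 2) fun s hs => (hδ' (by
      rw [NNReal.dist_eq] at hr ⊢
      have : (s : ℝ) ≤ r := by exact_mod_cast hs
      simp only [NNReal.coe_zero, sub_zero, NNReal.abs_eq] at hr ⊢
      linarith)).le
    have e : W r x - x = (((r : ℝ) : 𝕜)⁻¹) • (V r x - ((r : ℝ) : 𝕜) • x) := by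
      rw [smul_sub, smul_smul, inv_mul_cancel₀ hrk, one_smul]; rfl
    rw [dist_eq_norm, e, norm_smul, norm_inv, RCLike.norm_ofReal, NNReal.abs_eq]
    calc _ ≤ (r : ℝ)⁻¹ * (ε / 2 * r) := by gcongr
      _ = ε / 2 := by field_simp
      _ < ε := by linarith
  have hWb : ∀ᶠ r in 𝓝[≠] (0 : ℝ≥0), ‖W r‖ ≤ C + 1 := by
    have h1 : Tendsto (fun h : ℝ≥0 => C * Real.exp (b * h)) (𝓝[≠] 0) (𝓝 C) := by
      have h1 : Continuous fun h : ℝ≥0 => C * Real.exp (b * h) := by fun_prop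
      simpa using (h1.tendsto 0).mono_left nhdsWithin_le_nhds
    filter_upwards [h1.eventually_lt_const (lt_add_one C), self_mem_nhdsWithin] with r hr hr0
    have hr' : 0 < (r : ℝ) := by exact_mod_cast pos_iff_ne_zero.2 hr0
    rw [hW, norm_smul, norm_inv, RCLike.norm_ofReal, NNReal.abs_eq, inv_mul_le_iff₀ hr']
    refine (hVn r).trans ?_
    rw [mul_comm (r : ℝ)]
    gcongr
  have hlim : Tendsto (fun r => StrongDual.toWeakDual (φ.comp ((W r).comp (W r)))) (𝓝[≠] 0)
      (𝓝 φ') := by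
    rw [tendsto_iff_forall_eval_tendsto_topDualPairing]
    intro x
    exact (φ.continuous.tendsto x).comp (tendsto_apply_apply hWb (hWx x) (hWx x))
  refine mem_closure_of_tendsto hlim (Eventually.of_forall fun r => ⟨_, ?_, rfl⟩)
  have e : φ.comp ((W r).comp (W r)) =
      ((((r : ℝ) : 𝕜)⁻¹) * (((r : ℝ) : 𝕜)⁻¹)) • φ.comp ((V r).comp (V r)) := by
    ext x
    simp [hW, smul_smul, mul_assoc]
  rw [e]
  exact Submodule.smul_mem _ _ ⟨_, hdom φ r⟩

end IntegratedSemigroup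

section Main

variable {𝕜 X : Type*} [RCLike 𝕜] [NormedAddCommGroup X] [NormedSpace 𝕜 X]

theorem mem_graph_strongDeriv {S : ℝ≥0 → X →L[𝕜] X} {x z : X} :
    (x, z) ∈ (strongDeriv S).graph ↔ HasStrongDerivAtZero S x z := by
  rw [LinearPMap.mem_graph_iff]
  constructor
  · rintro ⟨y, hy, hy'⟩
    simp only at hy hy'
    subst hy hy'
    exact strongDeriv_apply S y
  · intro h
    exact ⟨⟨x, z, h⟩, rfl, (strongDeriv_apply S ⟨x, z, h⟩).unique h⟩

theorem IsC0Semigroup.pow_eq {T : ℝ≥0 → X →L[𝕜] X} (hT : IsC0Semigroup T) (s : ℝ≥0) (m : ℕ) :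
    T s ^ m = T (m * s) := by
  induction m with
  | zero => rw [pow_zero, Nat.cast_zero, zero_mul, hT.map_zero]; rfl
  | succ m ih =>
    rw [pow_succ, ih, Nat.cast_succ, add_mul, one_mul, hT.map_add]; rfl

theorem weaklySeqRelCompact_of_tendsto {u : ℕ → X} {x : X} (h : Tendsto u atTop (𝓝 x)) :
    WeaklySeqRelCompact 𝕜 u := by
  intro p hp
  refine ⟨id, strictMono_id, x, ?_⟩
  exact ((toWeakSpaceCLM 𝕜 X).continuous.tendsto x).comp (h.comp hp.tendsto_atTop)

theorem isChernoffClass_of_isC0Semigroup {T : ℝ≥0 → X →L[𝕜] X} (hT : IsC0Semigroup T)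
    (hd : Dense ((strongDeriv T).domain : Set X)) : IsChernoffClass T := by
  refine ⟨hT.map_zero, ?_, hd⟩
  obtain ⟨M, a, hM, hb⟩ := hT.bound
  refine ⟨M, a, hM.le, fun n m hn s => ?_⟩
  rw [hT.pow_eq]
  refine (hb _).trans_eq ?_
  push_cast
  congr 2
  ring

theorem tendsto_floor_mul_div (s t : ℝ≥0) :
    Tendsto (fun n : ℕ => (⌊n * s⌋₊ : ℝ≥0) * (t / n)) atTop (𝓝 (s * t)) := by
  rw [← NNReal.tendsto_coe]
  have h1 := ((tendsto_nat_floor_mul_div_atTop (R := ℝ) (a := (s : ℝ)) s.2).comp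
    tendsto_natCast_atTop_atTop).mul_const (t : ℝ)
  push_cast
  refine h1.congr fun n => ?_
  simp only [Function.comp_apply]
  have e : ⌊(n : ℝ≥0) * s⌋₊ = ⌊(s : ℝ) * n⌋₊ := by rw [mul_comm (s : ℝ)]; rfl
  rw [e]
  ring

variable [CompleteSpace X]

/-- A semigroup generated by the closure of `Z` satisfies the Chernoff conditions itself. -/
theorem chernoffConditions_of_isGeneratorOf {Z : X →ₗ.[𝕜] X} (hcl : Z.IsClosable)
    (hZ : Dense (Z.domain : Set X)) {T : ℝ≥0 → X →L[𝕜] X} (hT : IsGeneratorOf Z.closure T)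
    (t : ℝ≥0) : ChernoffConditions t Z T := by
  obtain ⟨hT, hgen⟩ := hT
  refine ⟨hgen ▸ Z.le_closure, hT.weakStarDense_strongDeriv_dualFun,
    Z.domain, le_rfl, hZ, fun f hf s => ?_⟩
  set z := Z ⟨f, hf⟩ with hz
  have hfz : HasStrongDerivAtZero T f z := by
    rw [← mem_graph_strongDeriv, hgen]
    exact LinearPMap.le_graph_of_le Z.le_closure (Z.mem_graph ⟨f, hf⟩)
  set r : ℕ → ℝ≥0 := fun n => ⌊n * s⌋₊ * (t / n) with hr
  have hrlim : Tendsto r atTop (𝓝 (s * t)) := tendsto_floor_mul_div s t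
  have hy := ((hT.continuous f).tendsto _).comp hrlim
  have hy' := ((hT.continuous z).tendsto _).comp hrlim
  have happ : ∀ n : ℕ, ∃ u : Z.domain, dist (u : X) (T (r n) f) < 1 / (n + 1) ∧
      dist (Z u) (T (r n) z) < 1 / (n + 1) := by
    intro n
    have h1 := mem_graph_strongDeriv.2 (hT.hasStrongDerivAtZero_apply hfz (r n))
    rw [hgen, ← hcl.graph_closure_eq_closure_graph, ← SetLike.mem_coe,
      Submodule.topologicalClosure_coe, Metric.mem_closure_iff] at h1
    obtain ⟨⟨x, x'⟩, hx, hd⟩ := h1 (1 / (n + 1)) (by positivity)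
    obtain ⟨w, hw, hw'⟩ := (LinearPMap.mem_graph_iff _).1 hx
    simp only at hw hw'
    subst hw hw'
    rw [dist_comm, Prod.dist_eq, max_lt_iff] at hd
    exact ⟨w, hd⟩
  choose u hu hu' using happ
  have hone : Tendsto (fun n : ℕ => 1 / ((n : ℝ) + 1)) atTop (𝓝 0) :=
    tendsto_one_div_add_atTop_nhds_zero_nat
  have hd0 : Tendsto (fun n => dist (u n : X) (T (r n) f)) atTop (𝓝 0) :=
    squeeze_zero (fun _ => dist_nonneg) (fun n => (hu n).le) hone
  have hd0' : Tendsto (fun n => dist (Z (u n)) (T (r n) z)) atTop (𝓝 0) :=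
    squeeze_zero (fun _ => dist_nonneg) (fun n => (hu' n).le) hone
  refine ⟨u, ?_, ?_, ?_⟩
  · refine hd0.congr fun n => ?_
    rw [dist_comm, dist_eq_norm, hT.pow_eq]
  · exact weaklySeqRelCompact_of_tendsto ((tendsto_iff_of_dist hd0).2 hy)
  · exact weaklySeqRelCompact_of_tendsto ((tendsto_iff_of_dist hd0').2 hy')

/-- The Chernoff conditions imply that the closure of `Z` generates the semigroup given by the
product formula. -/
theorem exists_isGeneratorOf_of_chernoffConditions {Z : X →ₗ.[𝕜] X}
    (hZ : Dense (Z.domain : Set X)) {t : ℝ≥0} (ht : 0 < t) {F : ℝ≥0 → X →L[𝕜] X}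
    (hF : IsChernoffClass F) (hcond : ChernoffConditions t Z F) :
    Z.IsClosable ∧ ∃ T : ℝ≥0 → X →L[𝕜] X, IsGeneratorOf Z.closure T ∧
      (∀ T' : ℝ≥0 → X →L[𝕜] X, IsGeneratorOf Z.closure T' → T' = T) ∧
      ∀ s : ℝ≥0, 0 < s → ∀ f : X,
        Tendsto (fun n : ℕ => (F (s / n) ^ n) f) atTop (𝓝 (T s f)) := by
  obtain ⟨h0, ⟨M, a₀, hM, hb⟩, -⟩ := hF
  set a := max a₀ 1 with ha'
  have ha : 0 < a := lt_max_of_lt_right one_pos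
  have hFb : ∀ (h : ℝ≥0) (k : ℕ), ‖F h ^ k‖ ≤ M * Real.exp (a * k * h) := by
    intro h k
    have h1 := hb 1 k one_pos h
    simp only [Nat.cast_one, div_one] at h1
    refine h1.trans ?_
    have : a₀ ≤ a := le_max_left _ _
    gcongr
  obtain ⟨R, hR, hRlim⟩ := exists_isResolventOf h0 hM ha hFb hZ hcond.extends_op fun c hc =>
    dense_range_of_chernoffConditions h0 hM ha hFb ht hcond (by linarith)
  have hcl : Z.IsClosable :=
    ⟨Z.graph.topologicalClosure.toLinearPMap, (Submodule.toLinearPMap_graph_eq _ (by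
      rintro ⟨x, z⟩ hx (rfl : x = 0)
      exact hR.eq_zero_of_mem hx)).symm⟩
  have hprod : ∀ T : ℝ≥0 → X →L[𝕜] X, IsGeneratorOf Z.closure T → ∀ s : ℝ≥0, 0 < s → ∀ f : X,
      Tendsto (fun n : ℕ => (F (s / n) ^ n) f) atTop (𝓝 (T s f)) := by
    rintro T ⟨hT, hgen⟩ s hs f
    refine tendsto_pow_apply_of_isResolventOf hM ha hFb hR hRlim hT (fun x z => ?_) hs f
    rw [← mem_graph_strongDeriv, hgen, hcl.graph_closure_eq_closure_graph]
  obtain ⟨T, hT, hTG⟩ := hR.exists_isC0Semigroup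
  have hTgen : IsGeneratorOf Z.closure T := by
    refine ⟨hT, LinearPMap.eq_of_eq_graph ?_⟩
    ext ⟨x, z⟩
    rw [mem_graph_strongDeriv, hTG, hcl.graph_closure_eq_closure_graph]
  refine ⟨hcl, T, hTgen, fun T' hT' => ?_, hprod T hTgen⟩
  funext s
  rcases eq_or_ne s 0 with rfl | hs
  · rw [hT.map_zero, hT'.1.map_zero]
  · ext f
    exact tendsto_nhds_unique (hprod T' hT' s (pos_iff_ne_zero.2 hs) f)
      (hprod T hTgen s (pos_iff_ne_zero.2 hs) f)

end Main

end ChernoffFormula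

theorem mainTheorem1 {𝕜 X : Type*} [RCLike 𝕜] [NormedAddCommGroup X] [NormedSpace 𝕜 X]
    [CompleteSpace X] (Z : X →ₗ.[𝕜] X) (hZ : Dense (Z.domain : Set X))
    (t : ℝ≥0) (ht : 0 < t) :
    ((Z.IsClosable ∧ ∃ T : ℝ≥0 → X →L[𝕜] X, ChernoffFormula.IsGeneratorOf Z.closure T) ↔
      ∃ F : ℝ≥0 → X →L[𝕜] X,
        ChernoffFormula.IsChernoffClass F ∧ ChernoffFormula.ChernoffConditions t Z F) ∧
    ∀ F : ℝ≥0 → X →L[𝕜] X,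
      ChernoffFormula.IsChernoffClass F → ChernoffFormula.ChernoffConditions t Z F →
      ∃ T : ℝ≥0 → X →L[𝕜] X, ChernoffFormula.IsGeneratorOf Z.closure T ∧
        (∀ T' : ℝ≥0 → X →L[𝕜] X, ChernoffFormula.IsGeneratorOf Z.closure T' → T' = T) ∧
        ∀ s : ℝ≥0, 0 < s → ∀ f : X,
          Tendsto (fun n : ℕ => (F (s / n) ^ n) f) atTop (𝓝 (T s f)) := by
  refine ⟨⟨?_, ?_⟩, fun F hF hcond =>
    (ChernoffFormula.exists_isGeneratorOf_of_chernoffConditions hZ ht hF hcond).2⟩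
  · rintro ⟨hcl, T, hT⟩
    refine ⟨T, ChernoffFormula.isChernoffClass_of_isC0Semigroup hT.1 ?_,
      ChernoffFormula.chernoffConditions_of_isGeneratorOf hcl hZ hT t⟩
    rw [hT.2]
    exact hZ.mono Z.le_closure.1
  · rintro ⟨F, hF, hcond⟩
    obtain ⟨hcl, T, hT, -⟩ :=
      ChernoffFormula.exists_isGeneratorOf_of_chernoffConditions hZ ht hF hcond
    exact ⟨hcl, T, hT⟩
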